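/- Let $W=\langle s,t,u\rangle$ be the universal Coxeter group of rank $3$, i.e. $m_{st}=m_{tu}=m_{us}=\infty$. Let $\Bbbk$ be a field of characteristic $0$ (for example $\Bbbk=\mathbb{R}$) and let $V$ be a (finite-dimensional, balanced) realization of $W$ over $\Bbbk$, with simple roots $\alpha_x\in V$ and simple coroots $\alpha_x^\vee\in V^*$, $x \in\{s,t,u\}$, such that $x(v)=v-\alpha_x^\vee(v)\alpha_x$, $\alpha_x^\vee(\alpha_x)=2$ and $\alpha_x^\vee(\alpha_y)=-2$ for $x\neq y$ (for example the geometric representation). Let $R=\mathrm{Sym}(V)$, graded with $\deg V=2$, let $R_+\subset R$ be the ideal generated by the homogeneous elements of positive degree, and $\Bbbk=R/R_+$. For an $R$-bimodule $B$ let $\bar B=\Bbbk\otimes_R B$, a right $R$-module. For $\underline w=stustu$ let $$\mathrm{BS}(\underline w)=R\otimes_{R^s}R\otimes_{R^t}R\otimes_{R^u}R\otimes_{R^s}R\otimes_{R^t}R\otimes_{R^u}R\,(6)$$ be the Bott–Samelson bimodule, graded so that $1\otimes\cdots\otimes1$ has degree $-6$. For $x\in\{s,t,u\}$ let $\varpi_x\in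 V$ be such that $\alpha_x^\vee(\varpi_x)=1$, let $c_x^1=1\otimes 1$ and $c_x^0=x(\varpi_x)\otimes 1-1\otimes\varpi_x$ in $R\otimes_{R^x}R$, and for $e\in\{0,1\}^6$ let $c_e=c_s^{e_1}\otimes_R c_t^{e_2}\otimes_R c_u^{e_3}\otimes_R c_s^{e_4}\otimes_R c_t^{e_5}\otimes_R c_u^{e_6}\in \mathrm{BS}(\underline w)$. Put $$b=c_{000011}-c_{000101}+c_{000110}-c_{001010}+c_{001100}-c_{010001}-2c_{010010}+c_{011000}-c_{010100}+c_{100001}-c_{100010}-c_{101000}+c_{110000}.$$ Then: 1. $b$ is homogeneous of degree $2$. 2. The image $\bar b=1\otimes b\in\overline{\mathrm{BS}(\underline w)}$ is annihilated by the right action of $R_+$. 3. Hence there is a map of right $R$-modules $\bar R=\Bbbk\to\overline{\mathrm{BS}(\underline w)}$ with $1\mapsto\bar b$, and this map is not of the form $\mathrm{id}_\Bbbk\otimes\varphi$ for any $R$-bimodule map $\varphi:R\to\mathrm{BS}(\underline w)$. 4. For $B=R$ and $B'=\mathrm{BS}(\underline w)$ (and homomorphisms of all degrees) $\Bbbk\otimes_R\mathrm{Hom}_{R\otimes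 R}(B,B')$ and $\mathrm{Hom}_R(\bar B,\bar B')$ are not isomorphic, not even as $\Bbbk$-vector spaces. In particular, the question whether $\Bbbk\otimes_R\mathrm{Hom}_{R\otimes R}(B,B')\cong\mathrm{Hom}_R(\bar B,\bar B')$ for all Soergel bimodules $B,B'$ of an arbitrary Coxeter group has a negative answer. -/

import Mathlib

open scoped TensorProduct
open MulOpposite

namespace SoergelModules

universe u v w

/-! ### Bimodules over a commutative ring

An `R`-bimodule is an additive group with commuting actions of `R` (on the left) and of `Rᵐᵒᵖ`
(on the right). -/

section Bimodules

variable {R : Type u} [CommRing R]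

/-- `Hom_{R ⊗ R}(M, N)`: the homomorphisms of `R`-bimodules (of all degrees), as a left
`R`-module. -/
def BimodHom (R : Type u) [CommRing R] (M : Type v) [AddCommGroup M] [Module R M] [Module Rᵐᵒᵖ M]
    (N : Type w) [AddCommGroup N] [Module R N] [Module Rᵐᵒᵖ N] [SMulCommClass R Rᵐᵒᵖ N] :
    Submodule R (M →ₗ[R] N) where
  carrier := {φ | ∀ (f : R) (x : M), φ (op f • x) = op f • φ x}
  add_mem' := by
    intro φ ψ hφ hψ f x
    simp only [LinearMap.add_apply, smul_add, hφ f x, hψ f x]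
  zero_mem' := by
    intro f x
    simp
  smul_mem' := by
    intro r φ hφ f x
    simp only [LinearMap.smul_apply, hφ f x, smul_comm]

/-- The right multiplication by `f` on a bimodule, as a map of left modules. -/
def rightMul (M : Type v) [AddCommGroup M] [Module R M] [Module Rᵐᵒᵖ M] [SMulCommClass R Rᵐᵒᵖ M]
    (f : R) : M →ₗ[R] M where
  toFun x := op f • x
  map_add' x y := smul_add _ x y
  map_smul' r x := (smul_comm r (op f) x).symm

/-- The reduction `R/I ⊗_R M` of a bimodule `M` on the left. -/
abbrev Reduction (I : Ideal R) (M : Type v) [AddCommGroup M] [Module R M] : Type (max u v) :=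
  (R ⧸ I) ⊗[R] M

/-- The right multiplication by `f` on `R/I ⊗_R M`. -/
def rightMulBar (I : Ideal R) (M : Type v) [AddCommGroup M] [Module R M] [Module Rᵐᵒᵖ M]
    [SMulCommClass R Rᵐᵒᵖ M] (f : R) : Reduction I M →ₗ[R] Reduction I M :=
  (rightMul M f).lTensor (R ⧸ I)

/-- `Hom_R(R/I ⊗_R M, R/I ⊗_R N)`: the `𝕜`-linear maps (of all degrees) that commute with
the right action of `R`. -/
def RightHom (𝕜 : Type w) [Field 𝕜] [Algebra 𝕜 R] (I : Ideal R)
    (M : Type v) [AddCommGroup M] [Module R M] [Module Rᵐᵒᵖ M] [SMulCommClass R Rᵐᵒᵖ M]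
    (N : Type v) [AddCommGroup N] [Module R N] [Module Rᵐᵒᵖ N] [SMulCommClass R Rᵐᵒᵖ N] :
    Submodule 𝕜 (Reduction I M →ₗ[𝕜] Reduction I N) where
  carrier := {ψ | ∀ (f : R) (x : Reduction I M),
    ψ (rightMulBar I M f x) = rightMulBar I N f (ψ x)}
  add_mem' := by
    intro φ ψ hφ hψ f x
    simp only [LinearMap.add_apply, map_add, hφ f x, hψ f x]
  zero_mem' := by
    intro f x
    simp
  smul_mem' := by
    intro c φ hφ f x
    simp only [LinearMap.smul_apply, hφ f x]
    rw [← algebraMap_smul R c (φ x), ← algebraMap_smul R c (rightMulBar I N f (φ x)), map_smul]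

end Bimodules

/-! ### Realizations of Coxeter groups -/

/-- The two-colored quantum numbers: `[0]_x = 0`, `[1]_x = 1`,
`[n + 2]_x = x [n + 1]_y - [n]_x`. -/
def twoColoredQuantum {𝕜 : Type u} [Field 𝕜] : 𝕜 → 𝕜 → ℕ → 𝕜
  | _, _, 0 => 0
  | _, _, 1 => 1
  | x, y, n + 2 => x * twoColoredQuantum y x (n + 1) - twoColoredQuantum x y n

/-- A balanced realization of a Coxeter system over `𝕜` on the vector space `V`. The balancedness
condition is void when `M i j = 0`, that is, when the product of the two simple reflections has
infinite order. -/
structure Realization {B : Type*} {W : Type*} [Group W] {M : CoxeterMatrix B}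
    (cs : CoxeterSystem M W) (𝕜 : Type u) [Field 𝕜] (V : Type v) [AddCommGroup V]
    [Module 𝕜 V] where
  /-- The representation of the group. -/
  ρ : Representation 𝕜 W V
  /-- The simple roots. -/
  root : B → V
  /-- The simple coroots. -/
  coroot : B → Module.Dual 𝕜 V
  root_ne_zero : ∀ i, root i ≠ 0
  coroot_ne_zero : ∀ i, coroot i ≠ 0
  coroot_root : ∀ i, coroot i (root i) = 2
  simple_apply : ∀ i v, ρ (cs.simple i) v = v - coroot i v • root i
  balanced : ∀ i j, i ≠ j → M i j ≠ 0 →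
    twoColoredQuantum (-coroot i (root j)) (-coroot j (root i)) (M i j - 1) = 1 ∧
    twoColoredQuantum (-coroot j (root i)) (-coroot i (root j)) (M i j - 1) = 1

/-- The Coxeter matrix of the universal Coxeter group on three generators: all off-diagonal
entries are infinite (encoded by `0`). -/
def universalThree : CoxeterMatrix (Fin 3) where
  M := Matrix.of fun i j => if i = j then 1 else 0
  isSymm := by ext i j; simp [eq_comm]
  diagonal := by simp
  off_diagonal := by intro i j hij; simp [hij]

/-! ### The polynomial ring `R = Sym(V)` -/

section SymV

variable (𝕜 : Type u) [Field 𝕜] (V : Type v) [AddCommGroup V] [Module 𝕜 V]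

/-- The ring `R = Sym(V)`. -/
abbrev SymV : Type (max u v) := SymmetricAlgebra 𝕜 V

/-- The homogeneous polynomials of polynomial degree `n`. In the grading with `deg V = 2`
they have degree `2 n`. -/
def polyHomogeneous (n : ℕ) : Submodule 𝕜 (SymV 𝕜 V) :=
  (LinearMap.range (SymmetricAlgebra.ι 𝕜 V)) ^ n

/-- The ideal `R_+` generated by the homogeneous polynomials of positive degree. -/
def polyPlus : Ideal (SymV 𝕜 V) :=
  Ideal.span {f | ∃ n : ℕ, 0 < n ∧ f ∈ polyHomogeneous 𝕜 V n}

end SymV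

/-! ### Bott–Samelson bimodules -/

section BottSamelson

variable {B : Type*} {W : Type*} [Group W] {M : CoxeterMatrix B} {cs : CoxeterSystem M W}
  {𝕜 : Type u} [Field 𝕜] {V : Type v} [AddCommGroup V] [Module 𝕜 V]

/-- The action of `W` on `R = Sym(V)` by algebra automorphisms. -/
noncomputable def Realization.polyAct (h : Realization cs 𝕜 V) (x : W) : SymV 𝕜 V →ₐ[𝕜] SymV 𝕜 V :=
  SymmetricAlgebra.lift (SymmetricAlgebra.ι 𝕜 V ∘ₗ h.ρ x)

/-- The subring `R^s` of invariants of the simple reflection `s`. -/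
noncomputable def Realization.invariants (h : Realization cs 𝕜 V) (s : B) :
    Subalgebra 𝕜 (SymV 𝕜 V) :=
  AlgHom.equalizer (h.polyAct (cs.simple s)) (AlgHom.id 𝕜 (SymV 𝕜 V))

/-- The ring `R ⊗_𝕜 R ⊗_𝕜 ⋯ ⊗_𝕜 R` with `ℓ + 1` factors. -/
abbrev PolyTensor (𝕜 : Type u) [Field 𝕜] (V : Type v) [AddCommGroup V] [Module 𝕜 V] (l : ℕ) :=
  PiTensorProduct 𝕜 (fun _ : Fin (l + 1) => SymV 𝕜 V)

/-- The element `1 ⊗ ⋯ ⊗ f ⊗ ⋯ ⊗ 1`, with `f` in the factor number `k` (starting from `0`). -/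
noncomputable def slot {l : ℕ} (k : Fin (l + 1)) : SymV 𝕜 V →ₐ[𝕜] PolyTensor 𝕜 V l :=
  PiTensorProduct.singleAlgHom (R := 𝕜) (A := fun _ : Fin (l + 1) => SymV 𝕜 V) k

/-- The relations that let an `s_k`-invariant polynomial move across the `k`-th tensor sign. -/
def bsIdeal (h : Realization cs 𝕜 V) {l : ℕ} (word : Fin l → B) : Ideal (PolyTensor 𝕜 V l) :=
  Ideal.span {z | ∃ (k : Fin l) (f : SymV 𝕜 V), f ∈ h.invariants (word k) ∧
    z = slot k.castSucc f - slot k.succ f}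

/-- The Bott–Samelson bimodule
`BS(s₁ s₂ ⋯ s_ℓ) = R ⊗_{R^{s₁}} R ⊗_{R^{s₂}} ⋯ ⊗_{R^{s_ℓ}} R`: the quotient of
`R ⊗_𝕜 R ⊗_𝕜 ⋯ ⊗_𝕜 R` by the relations
`⋯ ⊗ f g ⊗ g' ⊗ ⋯ = ⋯ ⊗ g ⊗ f g' ⊗ ⋯` with `f ∈ R^{s_k}` at the `k`-th tensor sign. -/
def BS (h : Realization cs 𝕜 V) {l : ℕ} (word : Fin l → B) : Type (max u v) :=
  PolyTensor 𝕜 V l ⧸ bsIdeal h word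

variable (h : Realization cs 𝕜 V) {l : ℕ} (word : Fin l → B)

noncomputable instance : CommRing (BS h word) :=
  inferInstanceAs (CommRing (PolyTensor 𝕜 V l ⧸ bsIdeal h word))

noncomputable instance : Algebra 𝕜 (BS h word) :=
  inferInstanceAs (Algebra 𝕜 (PolyTensor 𝕜 V l ⧸ bsIdeal h word))

/-- The projection from `R ⊗_𝕜 ⋯ ⊗_𝕜 R`. -/
noncomputable def BS.mk : PolyTensor 𝕜 V l →ₐ[𝕜] BS h word :=
  Ideal.Quotient.mkₐ 𝕜 (bsIdeal h word)

/-- The left action of `R`: multiplication on the first tensor factor. -/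
noncomputable instance : Module (SymV 𝕜 V) (BS h word) :=
  Module.compHom (BS h word) ((BS.mk h word).comp (slot 0)).toRingHom

/-- The right action of `R`: multiplication on the last tensor factor. -/
noncomputable instance : Module (SymV 𝕜 V)ᵐᵒᵖ (BS h word) :=
  Module.compHom (BS h word)
    (((BS.mk h word).comp (slot (Fin.last l))).toRingHom.comp
      (RingEquiv.toOpposite (SymV 𝕜 V)).symm.toRingHom)

theorem BS.left_smul_def (f : SymV 𝕜 V) (x : BS h word) :
    f • x = BS.mk h word (slot 0 f) * x := rfl

theorem BS.right_smul_def (f : SymV 𝕜 V) (x : BS h word) :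
    op f • x = BS.mk h word (slot (Fin.last l) f) * x := rfl

instance : SMulCommClass (SymV 𝕜 V) (SymV 𝕜 V)ᵐᵒᵖ (BS h word) where
  smul_comm f g x := by
    induction g using MulOpposite.rec' with
    | h g =>
      simp only [BS.left_smul_def, BS.right_smul_def]
      exact mul_left_comm _ _ _

/-- The component of degree `d` of `BS(s₁ ⋯ s_ℓ)`. Here `V` has degree `2` and the grading is
shifted so that `1 ⊗ ⋯ ⊗ 1` has degree `-ℓ`. -/
noncomputable def BS.degree (d : ℤ) : Submodule 𝕜 (BS h word) :=
  Submodule.span 𝕜 {x | ∃ (n : Fin (l + 1) → ℕ) (f : Fin (l + 1) → SymV 𝕜 V),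
    (∀ k, f k ∈ polyHomogeneous 𝕜 V (n k)) ∧ 2 * ∑ k, (n k : ℤ) - l = d ∧
    x = BS.mk h word (PiTensorProduct.tprod 𝕜 f)}

/-- The string basis element `c_e = c_{s₁}^{e₁} ⊗_R ⋯ ⊗_R c_{s_ℓ}^{e_ℓ}`, where
`c_s^1 = 1 ⊗ 1` and `c_s^0 = c_s = s(ϖ_s) ⊗ 1 - 1 ⊗ ϖ_s` in `R ⊗_{R^s} R`. -/
noncomputable def stringElt (ϖ : B → V) (e : Fin l → Fin 2) : BS h word :=
  BS.mk h word (∏ k : Fin l, if e k = 1 then 1 else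
    slot k.castSucc (SymmetricAlgebra.ι 𝕜 V (h.ρ (cs.simple (word k)) (ϖ (word k)))) -
      slot k.succ (SymmetricAlgebra.ι 𝕜 V (ϖ (word k))))

end BottSamelson

/-! ### The element `b` -/

section Counterexample

variable {W : Type*} [Group W] {cs : CoxeterSystem universalThree W}
  {𝕜 : Type u} [Field 𝕜] {V : Type v} [AddCommGroup V] [Module 𝕜 V]

/-- The expression `stustu`. -/
def stustu : Fin 6 → Fin 3 := ![0, 1, 2, 0, 1, 2]

/-- The element `b` of `BS(stustu)`. -/
noncomputable def bElt (h : Realization cs 𝕜 V) (ϖ : Fin 3 → V) : BS h stustu :=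
  let c : (Fin 6 → Fin 2) → BS h stustu := stringElt h stustu ϖ
  c ![0, 0, 0, 0, 1, 1] - c ![0, 0, 0, 1, 0, 1] + c ![0, 0, 0, 1, 1, 0]
    - c ![0, 0, 1, 0, 1, 0] + c ![0, 0, 1, 1, 0, 0] - c ![0, 1, 0, 0, 0, 1]
    - 2 * c ![0, 1, 0, 0, 1, 0] + c ![0, 1, 1, 0, 0, 0] - c ![0, 1, 0, 1, 0, 0]
    + c ![1, 0, 0, 0, 0, 1] - c ![1, 0, 0, 0, 1, 0] - c ![1, 0, 1, 0, 0, 0]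
    + c ![1, 1, 0, 0, 0, 0]

end Counterexample

end SoergelModules

open SoergelModules

namespace SoergelModules

universe u v

/-! ### Evaluating a Bott–Samelson bimodule at subexpressions. -/

section General

variable {B : Type*} {W : Type*} [Group W] {M : CoxeterMatrix B} {cs : CoxeterSystem M W}
  {𝕜 : Type u} [Field 𝕜] {V : Type v} [AddCommGroup V] [Module 𝕜 V]

local notation "ιV" => SymmetricAlgebra.ι 𝕜 V

/-! Evaluation at `1` turns both Hom spaces into subspaces of the finite-dimensional space `𝕜 ⊗_R
BS(stustu)`. Bimodule maps `R → BS` are the elements on which the left and right actions agree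
(`invariants`); right module maps `𝕜 → 𝕜 ⊗_R BS` are the vectors killed by `R_+` on the right. The
first subspace lies in the second, and `b̄` lies only in the second, so the dimensions differ.

The products `c_T` of crossings over sets `T` of tensor signs form a left basis of `BS`
(`stringBasis`). They are studied through evaluations `f₀ ⊗ ⋯ ⊗ f_l ↦ ∏ w_k(f_k)`, where `w_k` are
the partial products of a subexpression `E`: `c_T` evaluates to zero unless `T` misses `E`, and then
to a nonzero product of roots. The resulting system is triangular for inclusion.

An invariant evaluates to zero wherever the subexpression acts nontrivially on `V`. In `stustu` this
leaves only the empty subexpression and the three pairs of equal letters. Hence the invariants are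
generated by four explicit elements whose coefficients are string coordinates
(`eq_combination_of_mem_invariants`). Two facts follow: an invariant in `R_+ BS` lies in `R_+` times
the invariants, so `𝕜 ⊗_R Hom` embeds in `𝕜 ⊗_R BS` (`compareOne_injective`); and every invariant
has zero coordinate at `{0,1,2,3}`, where `b` has coordinate `1`, so `b̄` is not in the image.

That `R_+` kills `b̄` is a computation in the quotient ring `BS / R_+ BS`, using the quadratic
relations of the crossings (`stustu_annihilation_identity`). -/

theorem ι_injective : Function.Injective (SymmetricAlgebra.ι 𝕜 V) := by
  refine (injective_iff_map_eq_zero _).2 fun v hv => ?_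
  refine (Module.forall_dual_apply_eq_zero_iff 𝕜 v).1 fun f => ?_
  rw [← SymmetricAlgebra.lift_ι_apply f v, hv, map_zero]

instance : IsDomain (SymV 𝕜 V) :=
  (SymmetricAlgebra.equivMvPolynomial (Module.Basis.ofVectorSpace 𝕜 V)).toMulEquiv.isDomain _

/-- Two algebra maps out of `R` that agree on `V` act equally on an element as soon as the
elements of `V` do. -/
theorem mul_eq_mul_of_forall_ι {A : Type*} [CommRing A] [Algebra 𝕜 A] (F G : SymV 𝕜 V →ₐ[𝕜] A)
    (m : A) (hm : ∀ v, F (ιV v) * m = G (ιV v) * m) (f : SymV 𝕜 V) : F f * m = G f * m := by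
  induction f using SymmetricAlgebra.induction with
  | algebraMap r => simp
  | ι v => exact hm v
  | mul a b ha hb =>
    rw [map_mul, map_mul, mul_assoc, hb, mul_left_comm, ha]; ring
  | add a b ha hb => rw [map_add, map_add, add_mul, add_mul, ha, hb]

namespace Realization

variable (h : Realization cs 𝕜 V)

theorem polyAct_ι (x : W) (v : V) : h.polyAct x (ιV v) = ιV (h.ρ x v) := by
  simp [polyAct]

theorem polyAct_one : h.polyAct 1 = AlgHom.id 𝕜 _ := by
  apply SymmetricAlgebra.algHom_ext
  ext v
  simp [polyAct_ι]

theorem polyAct_mul (x y : W) : h.polyAct (x * y) = (h.polyAct x).comp (h.polyAct y) := by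
  apply SymmetricAlgebra.algHom_ext
  ext v
  simp [polyAct_ι]

theorem simple_simple (i : B) (v : V) : h.ρ (cs.simple i) (h.ρ (cs.simple i) v) = v := by
  rw [← Module.End.mul_apply, ← map_mul]
  simp

theorem mem_invariants {s : B} {f : SymV 𝕜 V} :
    f ∈ h.invariants s ↔ h.polyAct (cs.simple s) f = f := Iff.rfl

theorem ι_mem_invariants {s : B} {v : V} (hv : h.coroot s v = 0) : ιV v ∈ h.invariants s := by
  rw [mem_invariants, polyAct_ι, simple_apply, hv, zero_smul, sub_zero]

theorem ρ_ne_zero (x : W) {v : V} (hv : v ≠ 0) : h.ρ x v ≠ 0 := by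
  intro h0
  apply hv
  have : h.ρ x⁻¹ (h.ρ x v) = v := by
    rw [← Module.End.mul_apply, ← map_mul]; simp
  rw [← this, h0, map_zero]

end Realization

variable (h : Realization cs 𝕜 V) {l : ℕ} (word : Fin l → B)

namespace BS

/-- The element `1 ⊗ ⋯ ⊗ f ⊗ ⋯ ⊗ 1` of the Bott–Samelson bimodule. -/
noncomputable def place (k : Fin (l + 1)) : SymV 𝕜 V →ₐ[𝕜] BS h word := (mk h word).comp (slot k)

theorem place_apply (k : Fin (l + 1)) (f : SymV 𝕜 V) : place h word k f = mk h word (slot k f) :=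
  rfl

theorem smul_eq (f : SymV 𝕜 V) (x : BS h word) : f • x = place h word 0 f * x := rfl

theorem op_smul_eq (f : SymV 𝕜 V) (x : BS h word) :
    op f • x = place h word (Fin.last l) f * x := rfl

instance : IsScalarTower (SymV 𝕜 V) (BS h word) (BS h word) :=
  ⟨fun f x y => by simp only [smul_eq, smul_eq_mul, mul_assoc]⟩

instance : SMulCommClass (SymV 𝕜 V) (BS h word) (BS h word) :=
  ⟨fun f x y => by simp only [smul_eq, smul_eq_mul, mul_left_comm]⟩

instance : IsScalarTower 𝕜 (SymV 𝕜 V) (BS h word) :=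
  ⟨fun c f x => by simp only [smul_eq, map_smul, smul_mul_assoc]⟩

theorem mk_surjective : Function.Surjective (mk h word) := Ideal.Quotient.mk_surjective

theorem place_of_mem_invariants {k : Fin l} {f : SymV 𝕜 V} (hf : f ∈ h.invariants (word k)) :
    place h word k.succ f = place h word k.castSucc f := by
  symm
  rw [← sub_eq_zero, place_apply, place_apply, ← map_sub]
  exact Ideal.Quotient.eq_zero_iff_mem.2 (Ideal.subset_span ⟨k, f, hf, rfl⟩)

theorem _root_.SoergelModules.tprod_eq_prod_slot (f : Fin (l + 1) → SymV 𝕜 V) :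
    PiTensorProduct.tprod 𝕜 f = ∏ k, slot k (f k) := by
  have : ∀ k, slot k (f k) = PiTensorProduct.tprod 𝕜 (Pi.mulSingle k (f k)) := fun k => rfl
  simp_rw [this]
  rw [← PiTensorProduct.tprod_prod, Finset.univ_prod_mulSingle]

/-- The Bott–Samelson bimodule is generated as a ring by the polynomials in the various factors. -/
theorem mem_of_place_mem (S : Subalgebra 𝕜 (BS h word)) (hS : ∀ k f, place h word k f ∈ S)
    (x : BS h word) : x ∈ S := by
  obtain ⟨y, rfl⟩ := mk_surjective h word x
  induction y using PiTensorProduct.induction_on with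
  | smul_tprod r f =>
    rw [map_smul, tprod_eq_prod_slot, map_prod]
    exact S.smul_mem (S.prod_mem fun k _ => hS k _) r
  | add a b ha hb => rw [map_add]; exact S.add_mem ha hb

/-- The product of the simple reflections chosen by `E` in the first `k` places. -/
def partialProd (cs : CoxeterSystem M W) {l : ℕ} (word : Fin l → B) (E : Finset (Fin l)) :
    Fin (l + 1) → W :=
  Fin.partialProd fun k => if k ∈ E then cs.simple (word k) else 1

theorem partialProd_zero (E : Finset (Fin l)) : partialProd cs word E 0 = 1 :=
  Fin.partialProd_zero _

theorem partialProd_succ (E : Finset (Fin l)) (k : Fin l) :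
    partialProd cs word E k.succ =
      partialProd cs word E k.castSucc * if k ∈ E then cs.simple (word k) else 1 :=
  Fin.partialProd_succ _ _

/-- The evaluation of `R ⊗ ⋯ ⊗ R` at a subexpression. -/
noncomputable def tensorEval (E : Finset (Fin l)) : PolyTensor 𝕜 V l →ₐ[𝕜] SymV 𝕜 V :=
  PiTensorProduct.liftAlgHom
    ((MultilinearMap.mkPiAlgebra 𝕜 (Fin (l + 1)) (SymV 𝕜 V)).compLinearMap
      fun k => (h.polyAct (partialProd cs word E k)).toLinearMap)
    (by simp) (by intro x y; simp [Finset.prod_mul_distrib])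

theorem tensorEval_slot (E : Finset (Fin l)) (k : Fin (l + 1)) (f : SymV 𝕜 V) :
    tensorEval h word E (slot k f) = h.polyAct (partialProd cs word E k) f := by
  have h1 : slot k f = PiTensorProduct.tprod 𝕜 (Pi.mulSingle k f) := rfl
  have h2 : tensorEval h word E (slot k f) =
      ∏ j, h.polyAct (partialProd cs word E j) (Pi.mulSingle (M := fun _ => SymV 𝕜 V) k f j) := by
    rw [h1]
    exact PiTensorProduct.lift.tprod _
  rw [h2, Finset.prod_eq_single k, Pi.mulSingle_eq_same]
  · intro j _ hj
    rw [Pi.mulSingle_eq_of_ne hj, map_one]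
  · simp

/-- The evaluation of the Bott–Samelson bimodule at a subexpression. -/
noncomputable def eval (E : Finset (Fin l)) : BS h word →ₐ[𝕜] SymV 𝕜 V :=
  Ideal.Quotient.liftₐ (bsIdeal h word) (tensorEval h word E) (by
    -- Consecutive partial products differ by `s_k` or by `1`, and both fix an `s_k`-invariant
    -- polynomial.
    have hle : bsIdeal h word ≤ RingHom.ker (tensorEval h word E) := by
      refine Ideal.span_le.2 ?_
      rintro _ ⟨k, f, hf, rfl⟩
      rw [SetLike.mem_coe, RingHom.mem_ker, map_sub, tensorEval_slot, tensorEval_slot,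
        partialProd_succ, h.polyAct_mul, AlgHom.comp_apply, sub_eq_zero]
      congr 1
      split_ifs
      · exact ((h.mem_invariants).1 hf).symm
      · rw [h.polyAct_one, AlgHom.id_apply]
    exact fun a ha => hle ha)

theorem eval_place (E : Finset (Fin l)) (k : Fin (l + 1)) (f : SymV 𝕜 V) :
    eval h word E (place h word k f) = h.polyAct (partialProd cs word E k) f :=
  tensorEval_slot h word E k f

theorem eval_smul (E : Finset (Fin l)) (f : SymV 𝕜 V) (x : BS h word) :
    eval h word E (f • x) = f * eval h word E x := by
  rw [smul_eq, map_mul, eval_place, partialProd_zero, h.polyAct_one, AlgHom.id_apply]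

end BS
end General

/-! ### The string basis and its triangularity under evaluation. -/

section General

variable {B : Type*} {W : Type*} [Group W] {M : CoxeterMatrix B} {cs : CoxeterSystem M W}
  {𝕜 : Type u} [Field 𝕜] {V : Type v} [AddCommGroup V] [Module 𝕜 V]

local notation "ιV" => SymmetricAlgebra.ι 𝕜 V

variable (h : Realization cs 𝕜 V) {l : ℕ} (word : Fin l → B)

namespace BS

variable (ϖ : B → V)

/-- The element `c_s` at the `k`-th tensor sign. -/
noncomputable def crossing (k : Fin l) : BS h word :=
  place h word k.castSucc (ιV (h.ρ (cs.simple (word k)) (ϖ (word k)))) -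
    place h word k.succ (ιV (ϖ (word k)))

/-- The product of the elements `c_s` over a set of tensor signs. -/
noncomputable def crossingProd (T : Finset (Fin l)) : BS h word :=
  ∏ k ∈ T, crossing h word ϖ k

theorem stringElt_eq_crossingProd (e : Fin l → Fin 2) :
    stringElt h word ϖ e = crossingProd h word ϖ {k | e k ≠ 1} := by
  rw [stringElt, map_prod, crossingProd, Finset.prod_filter]
  refine Finset.prod_congr rfl fun k _ => ?_
  by_cases hk : e k = 1
  · simp [hk]
  · simp only [hk, if_false, ne_eq, not_false_eq_true, if_true, map_sub]
    rfl

variable {ϖ} (hϖ : ∀ i, h.coroot i (ϖ i) = 1)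
include hϖ

/-- Moving a vector across a tensor sign. -/
theorem place_succ_ι (k : Fin l) (v : V) :
    place h word k.succ (ιV v) =
      place h word k.castSucc (ιV (h.ρ (cs.simple (word k)) v)) -
        h.coroot (word k) v • crossing h word ϖ k := by
  set s := word k with hs
  set p := h.coroot s v
  -- Split `v` into an `s`-invariant vector, which crosses freely, and a multiple of `ϖ s`, whose
  -- crossing defect is `c_s` by definition.
  have h0 : h.coroot s (v - p • ϖ s) = 0 := by simp [hϖ, p]
  have h1 := place_of_mem_invariants h word (k := k) (h.ι_mem_invariants h0)
  have h2 : h.ρ (cs.simple s) (v - p • ϖ s) = v - p • ϖ s := by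
    rw [h.simple_apply, h0, zero_smul, sub_zero]
  have h3 : place h word k.succ (ιV (v - p • ϖ s)) =
      place h word k.castSucc (ιV (h.ρ (cs.simple s) (v - p • ϖ s))) := by rw [h2, h1]
  simp only [map_sub, map_smul] at h3
  rw [crossing, ← hs, smul_sub]
  linear_combination h3

/-- The sum and the product of `ϖ` and `s(ϖ)` are `s`-invariant, so `y = 1 ⊗ ϖ` satisfies `(y - ϖ)(y
- s(ϖ)) = 0` with coefficients on the left. Here `c_s = s(ϖ) - y` and `c_s + α_s = ϖ - y`. -/
theorem crossing_sq (k : Fin l) :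
    crossing h word ϖ k * crossing h word ϖ k =
      -(place h word k.castSucc (ιV (h.root (word k))) * crossing h word ϖ k) := by
  set s := word k with hs
  have hsϖ : h.ρ (cs.simple s) (ϖ s) = ϖ s - h.root s := by
    rw [h.simple_apply, hϖ, one_smul]
  have hinv : h.ρ (cs.simple s) (ϖ s - h.root s) = ϖ s := by
    rw [← hsϖ, h.simple_simple]
  have h1 := place_of_mem_invariants h word (k := k)
    (f := ιV (ϖ s) + ιV (ϖ s - h.root s)) (by
      rw [h.mem_invariants, ← hs, map_add, h.polyAct_ι, h.polyAct_ι, hsϖ, hinv, add_comm])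
  have h2 := place_of_mem_invariants h word (k := k)
    (f := ιV (ϖ s) * ιV (ϖ s - h.root s)) (by
      rw [h.mem_invariants, ← hs, map_mul, h.polyAct_ι, h.polyAct_ι, hsϖ, hinv, mul_comm])
  rw [crossing, ← hs, hsϖ]
  simp only [map_sub, map_add, map_mul] at h1 h2 ⊢
  linear_combination place h word k.succ (ιV (ϖ s)) * h1 - h2

/-- For a vector, the defect `s(v) - v` and the term from `c_s²` are opposite multiples of `α_s c_s`
and cancel; general polynomials follow multiplicatively. A crossed tensor sign is thus transparent
to all of `R`. -/
theorem place_succ_mul_crossing (k : Fin l) (f : SymV 𝕜 V) :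
    place h word k.succ f * crossing h word ϖ k =
      place h word k.castSucc f * crossing h word ϖ k := by
  refine mul_eq_mul_of_forall_ι _ _ _ (fun v => ?_) f
  rw [place_succ_ι h word hϖ, h.simple_apply, sub_mul, smul_mul_assoc, crossing_sq h word hϖ]
  simp only [map_sub, map_smul, sub_mul, smul_mul_assoc, smul_neg]
  ring

theorem crossing_mul_crossingProd_of_mem {k : Fin l} {T : Finset (Fin l)} (hk : k ∈ T) :
    crossing h word ϖ k * crossingProd h word ϖ T =
      -(place h word k.castSucc (ιV (h.root (word k))) * crossingProd h word ϖ T) := by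
  rw [crossingProd, ← Finset.mul_prod_erase T _ hk, ← mul_assoc, crossing_sq h word hϖ, neg_mul,
    mul_assoc]

omit hϖ in
theorem crossing_mul_crossingProd_of_notMem {k : Fin l} {T : Finset (Fin l)} (hk : k ∉ T) :
    crossing h word ϖ k * crossingProd h word ϖ T = crossingProd h word ϖ (insert k T) := by
  rw [crossingProd, crossingProd, Finset.prod_insert hk]

/-- A vector is pushed leftwards one tensor sign at a time until it acts as a scalar. Both `v` and
`T` stay quantified in the induction: the reflection changes `v`, and induction is also applied to a
root. -/
theorem place_ι_mul_crossingProd_mem (k : Fin (l + 1)) : ∀ (v : V) (T : Finset (Fin l)),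
    place h word k (ιV v) * crossingProd h word ϖ T ∈
      Submodule.span (SymV 𝕜 V) (Set.range (crossingProd h word ϖ)) := by
  induction k using Fin.induction with
  | zero =>
    intro v T
    rw [← smul_eq]
    exact Submodule.smul_mem _ _ (Submodule.subset_span ⟨T, rfl⟩)
  | succ k ih =>
    intro v T
    rw [place_succ_ι h word hϖ, sub_mul, smul_mul_assoc,
      ← algebraMap_smul (SymV 𝕜 V) (h.coroot (word k) v)]
    refine Submodule.sub_mem _ (ih _ T) (Submodule.smul_mem _ _ ?_)
    by_cases hk : k ∈ T
    · rw [crossing_mul_crossingProd_of_mem h word hϖ hk]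
      exact Submodule.neg_mem _ (ih _ T)
    · rw [crossing_mul_crossingProd_of_notMem h word hk]
      exact Submodule.subset_span ⟨_, rfl⟩

theorem span_crossingProd :
    Submodule.span (SymV 𝕜 V) (Set.range (crossingProd h word ϖ)) = ⊤ := by
  set N := Submodule.span (SymV 𝕜 V) (Set.range (crossingProd h word ϖ)) with hN
  -- The stabilizer of the span is a subalgebra. It contains all the generators, hence everything,
  -- and the span contains `1`.
  let S : Subalgebra 𝕜 (BS h word) :=
    { carrier := {a | ∀ n ∈ N, a * n ∈ N}
      mul_mem' := fun ha hb n hn => by rw [mul_assoc]; exact ha _ (hb _ hn)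
      add_mem' := fun ha hb n hn => by rw [add_mul]; exact N.add_mem (ha _ hn) (hb _ hn)
      algebraMap_mem' := fun r n hn => by
        rw [← Algebra.smul_def, ← algebraMap_smul (SymV 𝕜 V) r]
        exact N.smul_mem _ hn }
  have hS : ∀ k f, place h word k f ∈ S := by
    intro k f
    induction f using SymmetricAlgebra.induction with
    | algebraMap r => rw [AlgHom.commutes]; exact S.algebraMap_mem r
    | mul a b ha hb => rw [map_mul]; exact S.mul_mem ha hb
    | add a b ha hb => rw [map_add]; exact S.add_mem ha hb
    | ι v =>
      intro n hn
      induction hn using Submodule.span_induction with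
      | mem x hx =>
        obtain ⟨T, rfl⟩ := hx
        exact place_ι_mul_crossingProd_mem h word hϖ k v T
      | zero => rw [mul_zero]; exact N.zero_mem
      | add x y _ _ hx hy => rw [mul_add]; exact N.add_mem hx hy
      | smul r x _ hx => rw [mul_smul_comm]; exact N.smul_mem _ hx
  have h1 : (1 : BS h word) ∈ N := Submodule.subset_span ⟨∅, by simp [crossingProd]⟩
  rw [eq_top_iff]
  intro a _
  have := mem_of_place_mem h word S hS a 1 h1
  rwa [mul_one] at this

/-- If `k ∈ E`, the extra reflection on the right factor matches the one built into `c_s` and the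
terms cancel; otherwise `s(ϖ) - ϖ = -α_s` remains. -/
theorem eval_crossing (E : Finset (Fin l)) (k : Fin l) :
    eval h word E (crossing h word ϖ k) = if k ∈ E then 0 else
      -ιV (h.ρ (partialProd cs word E k.castSucc) (h.root (word k))) := by
  rw [crossing, map_sub, eval_place, eval_place, partialProd_succ, h.polyAct_mul,
    AlgHom.comp_apply]
  split_ifs
  · rw [h.polyAct_ι (cs.simple _), sub_self]
  · rw [h.polyAct_one, AlgHom.id_apply, h.polyAct_ι, h.polyAct_ι, ← map_sub, ← map_sub,
      h.simple_apply, hϖ, one_smul, ← map_neg, ← map_neg]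
    congr 2
    abel

theorem eval_crossingProd_eq_zero {E T : Finset (Fin l)} (hET : ¬ T ⊆ Eᶜ) :
    eval h word E (crossingProd h word ϖ T) = 0 := by
  obtain ⟨k, hk, hkE⟩ := Finset.not_subset.1 hET
  rw [crossingProd, map_prod]
  refine Finset.prod_eq_zero hk ?_
  rw [eval_crossing h word hϖ, if_pos (by simpa using hkE)]

theorem eval_crossingProd_ne_zero {E T : Finset (Fin l)} (hET : T ⊆ Eᶜ) :
    eval h word E (crossingProd h word ϖ T) ≠ 0 := by
  rw [crossingProd, map_prod]
  refine Finset.prod_ne_zero_iff.2 fun k hk => ?_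
  rw [eval_crossing h word hϖ, if_neg (by simpa using hET hk), neg_ne_zero]
  exact (map_ne_zero_iff _ ι_injective).2 (h.ρ_ne_zero _ (h.root_ne_zero _))

/-- If `∑ r_T c_T` vanishes at `E` and all coefficients `r_T` with `T` in the complement of `E`
are zero, except possibly one, then that one is zero as well. -/
theorem coeff_eq_zero_of_eval_eq_zero (r : Finset (Fin l) → SymV 𝕜 V) {E T : Finset (Fin l)}
    (hTE : T ⊆ Eᶜ) (hr : ∀ T' ⊆ Eᶜ, T' ≠ T → r T' = 0)
    (h0 : eval h word E (∑ T, r T • crossingProd h word ϖ T) = 0) : r T = 0 := by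
  rw [map_sum, Finset.sum_eq_single T] at h0
  · rw [eval_smul] at h0
    exact (mul_eq_zero.1 h0).resolve_right (eval_crossingProd_ne_zero h word hϖ hTE)
  · intro T' _ hT'
    rw [eval_smul]
    by_cases hs : T' ⊆ Eᶜ
    · rw [hr T' hs hT', zero_mul]
    · rw [eval_crossingProd_eq_zero h word hϖ hs, mul_zero]
  · simp

/-- The vanishing of the coefficients of `∑ r_T c_T` from the vanishing of its evaluations. -/
theorem coeff_eq_zero_of_forall_subset (r : Finset (Fin l) → SymV 𝕜 V) (T : Finset (Fin l))
    (h0 : ∀ T' ⊆ T, eval h word T'ᶜ (∑ T, r T • crossingProd h word ϖ T) = 0) : r T = 0 := by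
  -- Evaluation at `Tᶜ` sees only coefficients indexed by subsets of `T`, and the proper ones vanish
  -- by induction.
  induction T using Finset.strongInduction with
  | H T ih =>
    refine coeff_eq_zero_of_eval_eq_zero h word hϖ r (E := Tᶜ) (by simp) (fun T' hT' hne => ?_)
      (h0 T subset_rfl)
    rw [compl_compl] at hT'
    exact ih T' (hT'.ssubset_of_ne hne) fun T'' hT'' => h0 T'' (hT''.trans hT')

theorem linearIndependent_crossingProd :
    LinearIndependent (SymV 𝕜 V) (crossingProd h word ϖ) := by
  rw [Fintype.linearIndependent_iff]
  intro r hr T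
  refine coeff_eq_zero_of_forall_subset h word hϖ r T fun T' _ => ?_
  rw [hr, map_zero]

/-- The string basis of the Bott–Samelson bimodule as a left module. -/
noncomputable def stringBasis : Module.Basis (Finset (Fin l)) (SymV 𝕜 V) (BS h word) :=
  Module.Basis.mk (linearIndependent_crossingProd h word hϖ) (span_crossingProd h word hϖ).ge

theorem stringBasis_apply (T : Finset (Fin l)) :
    stringBasis h word hϖ T = crossingProd h word ϖ T := Module.Basis.mk_apply _ _ _

theorem repr_crossingProd (T T' : Finset (Fin l)) :
    (stringBasis h word hϖ).repr (crossingProd h word ϖ T) T' = if T = T' then 1 else 0 := by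
  rw [← stringBasis_apply h word hϖ, Module.Basis.repr_self, Finsupp.single_apply]

theorem sum_repr_smul_crossingProd (m : BS h word) :
    ∑ T, (stringBasis h word hϖ).repr m T • crossingProd h word ϖ T = m := by
  simp_rw [← stringBasis_apply h word hϖ]
  exact (stringBasis h word hϖ).sum_repr m

omit hϖ in
/-- Invariants of the bimodule vanish at the subexpressions with a nontrivial product. -/
theorem eval_eq_zero_of_invariant {m : BS h word}
    (hm : ∀ f : SymV 𝕜 V, op f • m = f • m) {E : Finset (Fin l)} {v : V}
    (hv : h.ρ (partialProd cs word E (Fin.last l)) v ≠ v) : eval h word E m = 0 := by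
  -- Evaluating gives `(w(v) - v) * eval m = 0` in a domain, with `w` the product of the
  -- subexpression.
  have := congrArg (eval h word E) (hm (ιV v))
  rw [op_smul_eq, eval_smul, map_mul, eval_place, h.polyAct_ι, ← sub_eq_zero, ← sub_mul,
    ← map_sub] at this
  refine (mul_eq_zero.1 this).resolve_left ?_
  exact (map_ne_zero_iff _ ι_injective).2 (sub_ne_zero.2 hv)

end BS
end General

/-! ### Gradings and the augmentation ideal. -/

section Grading

variable {𝕜 : Type u} [Field 𝕜] {V : Type v} [AddCommGroup V] [Module 𝕜 V]

local notation "ιV" => SymmetricAlgebra.ι 𝕜 V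

theorem polyHomogeneous_mul_mem {m n : ℕ} {f g : SymV 𝕜 V} (hf : f ∈ polyHomogeneous 𝕜 V m)
    (hg : g ∈ polyHomogeneous 𝕜 V n) : f * g ∈ polyHomogeneous 𝕜 V (m + n) := by
  rw [polyHomogeneous, pow_add]
  exact Submodule.mul_mem_mul hf hg

theorem one_mem_polyHomogeneous : (1 : SymV 𝕜 V) ∈ polyHomogeneous 𝕜 V 0 := by
  rw [polyHomogeneous, pow_zero]
  exact Submodule.one_le.1 le_rfl

theorem ι_mem_polyHomogeneous (v : V) : ιV v ∈ polyHomogeneous 𝕜 V 1 := by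
  rw [polyHomogeneous, pow_one]
  exact LinearMap.mem_range_self _ v

theorem polyPlus_eq_span : polyPlus 𝕜 V = Ideal.span (Set.range ιV) := by
  refine le_antisymm (Ideal.span_le.2 ?_) (Ideal.span_mono ?_)
  · rintro f ⟨n, hn, hf⟩
    obtain ⟨n, rfl⟩ := Nat.exists_eq_succ_of_ne_zero hn.ne'
    rw [polyHomogeneous, pow_succ] at hf
    have hle : LinearMap.range ιV ^ n * LinearMap.range ιV ≤
        (Ideal.span (Set.range ιV)).restrictScalars 𝕜 := by
      refine Submodule.mul_le.2 ?_
      rintro a _ _ ⟨v, rfl⟩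
      exact Ideal.mul_mem_left _ _ (Ideal.subset_span ⟨v, rfl⟩)
    exact hle hf
  · rintro _ ⟨v, rfl⟩
    exact ⟨1, one_pos, ι_mem_polyHomogeneous v⟩

theorem ι_mem_polyPlus (v : V) : ιV v ∈ polyPlus 𝕜 V := by
  rw [polyPlus_eq_span]
  exact Ideal.subset_span ⟨v, rfl⟩

theorem one_notMem_polyPlus : (1 : SymV 𝕜 V) ∉ polyPlus 𝕜 V := by
  intro h1
  have hle : polyPlus 𝕜 V ≤ RingHom.ker (SymmetricAlgebra.algebraMapInv (R := 𝕜) (M := V)) := by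
    rw [polyPlus_eq_span]
    refine Ideal.span_le.2 ?_
    rintro _ ⟨v, rfl⟩
    exact SymmetricAlgebra.algebraMapInv_ι v
  have := hle h1
  rw [RingHom.mem_ker, map_one] at this
  exact one_ne_zero this

theorem exists_sub_algebraMap_mem_polyPlus (f : SymV 𝕜 V) :
    ∃ r : 𝕜, f - algebraMap 𝕜 _ r ∈ polyPlus 𝕜 V := by
  induction f using SymmetricAlgebra.induction with
  | algebraMap r => exact ⟨r, by simp⟩
  | ι v => exact ⟨0, by simpa using ι_mem_polyPlus v⟩
  | add a b ha hb =>
    obtain ⟨r, hr⟩ := ha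
    obtain ⟨s, hs⟩ := hb
    refine ⟨r + s, ?_⟩
    rw [map_add, add_sub_add_comm]
    exact Ideal.add_mem _ hr hs
  | mul a b ha hb =>
    obtain ⟨r, hr⟩ := ha
    obtain ⟨s, hs⟩ := hb
    refine ⟨r * s, ?_⟩
    have : a * b - algebraMap 𝕜 (SymV 𝕜 V) (r * s) =
        b * (a - algebraMap 𝕜 _ r) + algebraMap 𝕜 _ r * (b - algebraMap 𝕜 _ s) := by
      rw [map_mul]; ring
    rw [this]
    exact Ideal.add_mem _ (Ideal.mul_mem_left _ _ hr) (Ideal.mul_mem_left _ _ hs)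

instance : Module.Finite 𝕜 (SymV 𝕜 V ⧸ polyPlus 𝕜 V) := by
  refine Module.Finite.of_surjective (Algebra.linearMap 𝕜 (SymV 𝕜 V ⧸ polyPlus 𝕜 V)) ?_
  intro x
  obtain ⟨f, rfl⟩ := Ideal.Quotient.mk_surjective x
  obtain ⟨r, hr⟩ := exists_sub_algebraMap_mem_polyPlus f
  exact ⟨r, (Ideal.Quotient.eq.2 hr).symm⟩

/-- The tensors of total polynomial degree `n`. -/
def tensorHomogeneous (𝕜 : Type u) [Field 𝕜] (V : Type v) [AddCommGroup V] [Module 𝕜 V] (l n : ℕ) :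
    Submodule 𝕜 (PolyTensor 𝕜 V l) :=
  Submodule.span 𝕜 {x | ∃ (n' : Fin (l + 1) → ℕ) (f : Fin (l + 1) → SymV 𝕜 V),
    (∀ k, f k ∈ polyHomogeneous 𝕜 V (n' k)) ∧ ∑ k, n' k = n ∧ x = PiTensorProduct.tprod 𝕜 f}

variable {l : ℕ}

theorem one_mem_tensorHomogeneous : 1 ∈ tensorHomogeneous 𝕜 V l 0 :=
  Submodule.subset_span ⟨0, 1, fun _ => one_mem_polyHomogeneous, by simp, rfl⟩

theorem slot_mem_tensorHomogeneous (k : Fin (l + 1)) (v : V) :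
    slot k (ιV v) ∈ tensorHomogeneous 𝕜 V l 1 := by
  refine Submodule.subset_span ⟨Pi.single k 1, Pi.mulSingle k (ιV v), fun j => ?_, by simp, rfl⟩
  by_cases hj : j = k
  · subst hj
    rw [Pi.mulSingle_eq_same, Pi.single_eq_same]
    exact ι_mem_polyHomogeneous v
  · rw [Pi.mulSingle_eq_of_ne hj, Pi.single_eq_of_ne hj]
    exact one_mem_polyHomogeneous

theorem mul_mem_tensorHomogeneous {m n : ℕ} {x y : PolyTensor 𝕜 V l}
    (hx : x ∈ tensorHomogeneous 𝕜 V l m) (hy : y ∈ tensorHomogeneous 𝕜 V l n) :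
    x * y ∈ tensorHomogeneous 𝕜 V l (m + n) := by
  have := Submodule.apply_mem_map₂ PiTensorProduct.mul hx hy
  rw [tensorHomogeneous, tensorHomogeneous, Submodule.map₂_span_span] at this
  refine Submodule.span_mono ?_ this
  rintro _ ⟨_, ⟨n₁, f₁, h₁, rfl, rfl⟩, _, ⟨n₂, f₂, h₂, rfl, rfl⟩, rfl⟩
  exact ⟨n₁ + n₂, f₁ * f₂, fun k => polyHomogeneous_mul_mem (h₁ k) (h₂ k),
    by simp [Finset.sum_add_distrib], PiTensorProduct.mul_tprod_tprod _ _⟩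

theorem prod_mem_tensorHomogeneous {κ : Type*} (s : Finset κ) (d : κ → ℕ)
    (x : κ → PolyTensor 𝕜 V l) (hx : ∀ k ∈ s, x k ∈ tensorHomogeneous 𝕜 V l (d k)) :
    ∏ k ∈ s, x k ∈ tensorHomogeneous 𝕜 V l (∑ k ∈ s, d k) := by
  classical
  induction s using Finset.induction_on with
  | empty => exact one_mem_tensorHomogeneous
  | insert a s ha ih =>
    rw [Finset.prod_insert ha, Finset.sum_insert ha]
    exact mul_mem_tensorHomogeneous (hx a (Finset.mem_insert_self a s))
      (ih fun k hk => hx k (Finset.mem_insert_of_mem hk))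

variable {B : Type*} {W : Type*} [Group W] {M : CoxeterMatrix B} {cs : CoxeterSystem M W}
  (h : Realization cs 𝕜 V) (word : Fin l → B)

theorem BS.mk_mem_degree {n : ℕ} {x : PolyTensor 𝕜 V l} (hx : x ∈ tensorHomogeneous 𝕜 V l n) :
    BS.mk h word x ∈ BS.degree h word (2 * n - l) := by
  have hle : tensorHomogeneous 𝕜 V l n ≤
      (BS.degree h word (2 * n - l)).comap (BS.mk h word).toLinearMap := by
    refine Submodule.span_le.2 ?_
    rintro _ ⟨n', f, hf, rfl, rfl⟩
    exact Submodule.subset_span ⟨n', f, hf, by push_cast; rfl, rfl⟩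
  exact hle hx

/-- The string basis element `c_e` has degree `ℓ - 2 ∑ e`. -/
theorem stringElt_mem_degree (ϖ : B → V) (e : Fin l → Fin 2) (d : ℤ)
    (hd : 2 * ((∑ k, if e k = 1 then 0 else 1 : ℕ) : ℤ) - l = d) :
    stringElt h word ϖ e ∈ BS.degree h word d := by
  rw [← hd]
  refine BS.mk_mem_degree h word (prod_mem_tensorHomogeneous _ _ _ fun k _ => ?_)
  split_ifs
  · exact one_mem_tensorHomogeneous
  · exact Submodule.sub_mem _ (slot_mem_tensorHomogeneous _ _) (slot_mem_tensorHomogeneous _ _)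

end Grading

theorem bElt_mem_degree {W : Type*} [Group W] {cs : CoxeterSystem universalThree W}
    {𝕜 : Type u} [Field 𝕜] {V : Type v} [AddCommGroup V] [Module 𝕜 V]
    (h : Realization cs 𝕜 V) (ϖ : Fin 3 → V) : bElt h ϖ ∈ BS.degree h stustu 2 := by
  -- Every index occurring in `b` has exactly four zeros, and `2 * 4 - 6 = 2`.
  have key : ∀ e, 2 * ((∑ k, if e k = 1 then 0 else 1 : ℕ) : ℤ) - (6 : ℕ) = 2 →
      stringElt h stustu ϖ e ∈ BS.degree h stustu 2 := fun e he =>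
    stringElt_mem_degree h stustu ϖ e 2 he
  have h2 : ∀ x ∈ BS.degree h stustu 2, 2 * x ∈ BS.degree h stustu 2 := fun x hx => by
    rw [two_mul]; exact Submodule.add_mem _ hx hx
  have add := fun {x y} => Submodule.add_mem (BS.degree h stustu 2) (x := x) (y := y)
  have sub := fun {x y} => Submodule.sub_mem (BS.degree h stustu 2) (x := x) (y := y)
  refine add (sub (sub (add (sub (add (sub (sub (add (sub (add (sub ?_ ?_) ?_) ?_) ?_) ?_)
    (h2 _ ?_)) ?_) ?_) ?_) ?_) ?_) ?_ <;> exact key _ (by decide)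

/-! ### Reduction modulo an ideal on the left. -/

section Reductions

variable {R : Type u} [CommRing R] (I : Ideal R) {N : Type v} [AddCommGroup N] [Module R N]

theorem Reduction.one_tmul_eq_zero {n : N} :
    ((1 : R ⧸ I) ⊗ₜ[R] n : Reduction I N) = 0 ↔ n ∈ I • (⊤ : Submodule R N) := by
  have h1 := TensorProduct.quotTensorEquivQuotSMul_mk_tmul (M := N) I 1 n
  rw [map_one, one_smul] at h1
  rw [← (TensorProduct.quotTensorEquivQuotSMul N I).map_eq_zero_iff, h1,
    Submodule.Quotient.mk_eq_zero]

theorem one_tmul_eq_zero_of_mem_smul_top {N : Type v} [AddCommMonoid N] [Module R N] {n : N}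
    (hn : n ∈ I • (⊤ : Submodule R N)) : (1 : R ⧸ I) ⊗ₜ[R] n = 0 := by
  refine Submodule.smul_induction_on hn (fun r hr n _ => ?_) fun x y hx hy => ?_
  · rw [← TensorProduct.smul_tmul, Algebra.smul_def, mul_one]
    change Ideal.Quotient.mk I r ⊗ₜ[R] n = 0
    rw [Ideal.Quotient.eq_zero_iff_mem.2 hr, TensorProduct.zero_tmul]
  · rw [TensorProduct.tmul_add, hx, hy, add_zero]

theorem Reduction.exists_eq_one_tmul (x : Reduction I N) :
    ∃ n : N, x = (1 : R ⧸ I) ⊗ₜ[R] n := by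
  induction x using TensorProduct.induction_on with
  | zero => exact ⟨0, by simp⟩
  | tmul a n =>
    obtain ⟨r, rfl⟩ := Ideal.Quotient.mk_surjective a
    refine ⟨r • n, ?_⟩
    rw [← TensorProduct.smul_tmul, Algebra.smul_def, mul_one]
    rfl
  | add x y hx hy =>
    obtain ⟨n, rfl⟩ := hx
    obtain ⟨m, rfl⟩ := hy
    exact ⟨n + m, by rw [TensorProduct.tmul_add]⟩

theorem _root_.Module.Basis.repr_mem_of_mem_smul_top {κ : Type*} (b : Module.Basis κ R N) {n : N}
    (hn : n ∈ I • (⊤ : Submodule R N)) (i : κ) : b.repr n i ∈ I := by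
  have := Submodule.mem_map_of_mem (f := b.coord i) hn
  rw [Submodule.map_smul''] at this
  exact Ideal.mul_le_left (Submodule.smul_mono le_rfl le_top this)

end Reductions

/-! ### The right action of `R_+` kills the image of `b`. -/

section Counterexample

/-- The computation in `BS / R_+ BS`: `C k` are the crossings, and `x`, `y`, `z` the pairings of a
vector with the coroots of `s`, `t`, `u`. The first factor is that vector in the last tensor slot,
pushed to the left end; the second is `b`. The hypotheses are `c_s² = -α_s c_s` with the root pushed
left in the same way. As the claim is linear in `x`, `y`, `z`, the certificate has one block for
each. -/
theorem stustu_annihilation_identity {A : Type*} [CommRing A] (C : Fin 6 → A) (x y z : A)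
    (q0 : C 0 * C 0 = 0)
    (q1 : C 1 * C 1 = -((2 * C 0) * C 1))
    (q2 : C 2 * C 2 = -((6 * C 0 + 2 * C 1) * C 2))
    (q3 : C 3 * C 3 = -((14 * C 0 + 6 * C 1 + 2 * C 2) * C 3))
    (q4 : C 4 * C 4 = -((38 * C 0 + 14 * C 1 + 6 * C 2 + 2 * C 3) * C 4))
    (q5 : C 5 * C 5 = -((98 * C 0 + 38 * C 1 + 14 * C 2 + 6 * C 3 + 2 * C 4) * C 5)) :
    (-((15 * x + 40 * y + 104 * z) * C 0 + (6 * x + 15 * y + 40 * z) * C 1 +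
      (2 * x + 6 * y + 15 * z) * C 2 + (x + 2 * y + 6 * z) * C 3 + (y + 2 * z) * C 4 + z * C 5)) * (
      C 0 * C 1 * C 2 * C 3 - C 0 * C 1 * C 2 * C 4 + C 0 * C 1 * C 2 * C 5 - C 0 * C 1 * C
      3 * C 5 + C 0 * C 1 * C 4 * C 5 - C 0 * C 2 * C 3 * C 4 - 2 * C 0 * C 2 * C 3 * C 5 +
      C 0 * C 3 * C 4 * C 5 - C 0 * C 2 * C 4 * C 5 + C 1 * C 2 * C 3 * C 4 - C 1 * C 2 * C
      3 * C 5 - C 1 * C 3 * C 4 * C 5 + C 2 * C 3 * C 4 * C 5) = 0 := by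
  linear_combination x * (-C 3 * C 4 * C 5 + 3 * C 2 * C 4 * C 5 - 3 * C 1 * C 4 * C 5 + 2 * C 2
      * C 3 * C 5 + C 1 * C 3 * C 5 + C 1 * C 2 * C 5 + C 2 * C 3 * C 4 - C 1 * C 2 * C 4 - C 1
      * C 2 * C 3) * q0
    + x * (-6 * C 0 * C 4 * C 5 - 2 * C 0 * C 2 * C 5 + 2 * C 0 * C 2 * C 4) * q1
    + x * (2 * C 0 * C 4 * C 5 - 2 * C 0 * C 1 * C 5 + 2 * C 0 * C 1 * C 4) * q2
    + x * (-C 2 * C 4 * C 5 + C 1 * C 4 * C 5 - C 0 * C 4 * C 5 + C 1 * C 2 * C 5 + 2 * C 0 * C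
      2 * C 5 + C 0 * C 1 * C 5 - C 1 * C 2 * C 4 + C 0 * C 2 * C 4 - C 0 * C 1 * C 2) * q3
    + y * (-2 * C 3 * C 4 * C 5 + 2 * C 2 * C 4 * C 5 + 6 * C 1 * C 3 * C 5 + 2 * C 1 * C 2 * C
      5 + 2 * C 2 * C 3 * C 4 - 2 * C 1 * C 2 * C 3) * q0
    + y * (C 3 * C 4 * C 5 - C 0 * C 4 * C 5 - C 2 * C 3 * C 5 + 3 * C 0 * C 3 * C 5 - 3 * C 0 *
      C 2 * C 5 - C 2 * C 3 * C 4 + C 0 * C 2 * C 4 + C 0 * C 2 * C 3) * q1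
    + y * (2 * C 1 * C 3 * C 5 + 4 * C 0 * C 3 * C 5 - 6 * C 0 * C 1 * C 5 - 2 * C 0 * C 1 * C
      3) * q2
    + y * (2 * C 1 * C 2 * C 5 + 4 * C 0 * C 2 * C 5 + 2 * C 0 * C 1 * C 5 - 2 * C 0 * C 1 * C
      2) * q3
    + y * (-C 2 * C 3 * C 5 + C 1 * C 3 * C 5 - C 0 * C 3 * C 5 + C 0 * C 2 * C 5 - C 0 * C 1 *
      C 5 - C 1 * C 2 * C 3 + C 0 * C 2 * C 3 + C 0 * C 1 * C 2) * q4
    + z * (-6 * C 3 * C 4 * C 5 - 2 * C 1 * C 4 * C 5 + 2 * C 1 * C 3 * C 5 + 6 * C 2 * C 3 * C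
      4 - 2 * C 1 * C 2 * C 4 - 6 * C 1 * C 2 * C 3) * q0
    + z * (2 * C 3 * C 4 * C 5 - 2 * C 0 * C 4 * C 5 + 2 * C 0 * C 3 * C 5 - 2 * C 2 * C 3 * C 4
      + 6 * C 0 * C 2 * C 4 + 2 * C 0 * C 2 * C 3) * q1
    + z * (-C 3 * C 4 * C 5 + C 0 * C 4 * C 5 + C 1 * C 3 * C 5 + 2 * C 0 * C 3 * C 5 - C 0 * C
      1 * C 5 + C 1 * C 3 * C 4 - C 0 * C 3 * C 4 + 3 * C 0 * C 1 * C 4 - 3 * C 0 * C 1 * C 3) *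
      q2
    + z * (-2 * C 1 * C 2 * C 4 + 2 * C 0 * C 2 * C 4 - 6 * C 0 * C 1 * C 2) * q3
    + z * (-2 * C 1 * C 2 * C 3 + 2 * C 0 * C 2 * C 3 + 2 * C 0 * C 1 * C 2) * q4
    + z * (-C 2 * C 3 * C 4 + C 1 * C 3 * C 4 - C 0 * C 3 * C 4 + C 0 * C 2 * C 4 - C 0 * C 1 *
      C 4 + C 1 * C 2 * C 3 + 2 * C 0 * C 2 * C 3 + C 0 * C 1 * C 3 - C 0 * C 1 * C 2) * q5

variable {W : Type*} [Group W] {cs : CoxeterSystem universalThree W}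
  {𝕜 : Type u} [Field 𝕜] {V : Type v} [AddCommGroup V] [Module 𝕜 V]
  (h : Realization cs 𝕜 V) {ϖ : Fin 3 → V}

local notation "ιV" => SymmetricAlgebra.ι 𝕜 V

theorem stringElt_eq_prod {B W : Type*} [Group W] {M : CoxeterMatrix B} {cs : CoxeterSystem M W}
    (h : Realization cs 𝕜 V) {l : ℕ} (word : Fin l → B) (ϖ : B → V) (e : Fin l → Fin 2) :
    stringElt h word ϖ e = ∏ k, if e k = 1 then 1 else BS.crossing h word ϖ k := by
  rw [stringElt, map_prod]
  refine Finset.prod_congr rfl fun k _ => ?_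
  rw [apply_ite (BS.mk h word), map_one, map_sub]
  rfl

theorem bElt_eq : let C := BS.crossing h stustu ϖ
    bElt h ϖ =
      C 0 * C 1 * C 2 * C 3 - C 0 * C 1 * C 2 * C 4 + C 0 * C 1 * C 2 * C 5 - C 0 * C 1 * C
      3 * C 5 + C 0 * C 1 * C 4 * C 5 - C 0 * C 2 * C 3 * C 4 - 2 * C 0 * C 2 * C 3 * C 5 +
      C 0 * C 3 * C 4 * C 5 - C 0 * C 2 * C 4 * C 5 + C 1 * C 2 * C 3 * C 4 - C 1 * C 2 * C
      3 * C 5 - C 1 * C 3 * C 4 * C 5 + C 2 * C 3 * C 4 * C 5 := by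
  simp only [bElt, stringElt_eq_prod, Fin.prod_univ_six]
  simp
  ring

/-- The ideal `R_+ BS(w)`. -/
noncomputable def BS.plusIdeal {B W : Type*} [Group W] {M : CoxeterMatrix B}
    {cs : CoxeterSystem M W} (h : Realization cs 𝕜 V) {l : ℕ} (word : Fin l → B) :
    Ideal (BS h word) :=
  Ideal.span (BS.place h word 0 '' polyPlus 𝕜 V)

theorem BS.mem_plusIdeal {B W : Type*} [Group W] {M : CoxeterMatrix B}
    {cs : CoxeterSystem M W} (h : Realization cs 𝕜 V) {l : ℕ} (word : Fin l → B) {a : BS h word}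
    (ha : a ∈ BS.plusIdeal h word) :
    a ∈ polyPlus 𝕜 V • (⊤ : Submodule (SymV 𝕜 V) (BS h word)) := by
  induction ha using Submodule.span_induction with
  | mem x hx =>
    obtain ⟨f, hf, rfl⟩ := hx
    rw [← mul_one (BS.place h word 0 f), ← BS.smul_eq]
    exact Submodule.smul_mem_smul hf trivial
  | zero => exact Submodule.zero_mem _
  | add x y _ _ hx hy => exact Submodule.add_mem _ hx hy
  | smul r x _ hx =>
    rw [smul_eq_mul]
    refine Submodule.smul_induction_on hx (fun f hf n _ => ?_) fun x y hx hy => ?_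
    · rw [mul_smul_comm]; exact Submodule.smul_mem_smul hf trivial
    · rw [mul_add]; exact Submodule.add_mem _ hx hy

/-- The right action of `V` on `b` lands in `R_+ BS(stustu)`. -/
theorem place_last_ι_mul_bElt_mem (hcartan : ∀ i j, i ≠ j → h.coroot i (h.root j) = -2)
    (hϖ : ∀ i, h.coroot i (ϖ i) = 1) (v : V) :
    BS.place h stustu (Fin.last 6) (ιV v) * bElt h ϖ ∈ BS.plusIdeal h stustu := by
  let π := Ideal.Quotient.mkₐ 𝕜 (BS.plusIdeal h stustu)
  let C : Fin 6 → BS h stustu ⧸ BS.plusIdeal h stustu :=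
    fun k => π (BS.crossing h stustu ϖ k)
  let Y : Fin 7 → V → BS h stustu ⧸ BS.plusIdeal h stustu :=
    fun k v => π (BS.place h stustu k (ιV v))
  let κ : Fin 3 → V → BS h stustu ⧸ BS.plusIdeal h stustu :=
    fun i v => algebraMap 𝕜 _ (h.coroot i v)
  -- In the leftmost slot a vector belongs to `R_+` and dies, so in each later slot it becomes a
  -- linear form in the crossings to its left.
  have hY0 : ∀ v, Y 0 v = 0 := fun v =>
    Ideal.Quotient.eq_zero_iff_mem.2 (Ideal.subset_span ⟨_, ι_mem_polyPlus v, rfl⟩)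
  have hY : ∀ (k : Fin 6) v, Y k.succ v =
      Y k.castSucc (h.ρ (cs.simple (stustu k)) v) - κ (stustu k) v * C k := fun k v => by
    simp only [Y, κ, C]
    rw [BS.place_succ_ι h stustu hϖ, map_sub, map_smul, Algebra.smul_def]
  have hC : ∀ k : Fin 6, C k * C k = -(Y k.castSucc (h.root (stustu k)) * C k) := fun k => by
    simp only [Y, C]
    rw [← map_mul, BS.crossing_sq h stustu hϖ, map_neg, map_mul]
  have κsame : ∀ i v, κ i (h.ρ (cs.simple i) v) = -κ i v := fun i v => by
    simp only [κ, h.simple_apply, map_sub, map_smul, h.coroot_root, smul_eq_mul, map_mul,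
      map_ofNat]
    ring
  have κne : ∀ i j, i ≠ j → ∀ v, κ i (h.ρ (cs.simple j) v) = κ i v + 2 * κ j v := by
    intro i j hij v
    simp only [κ, h.simple_apply, map_sub, map_smul, hcartan i j hij, smul_eq_mul, map_mul,
      map_neg, map_ofNat]
    ring
  have κroot : ∀ i, κ i (h.root i) = 2 := fun i => by
    simp only [κ, h.coroot_root, map_ofNat]
  have κroot_ne : ∀ i j, i ≠ j → κ i (h.root j) = -2 := fun i j hij => by
    simp only [κ, hcartan i j hij, map_neg, map_ofNat]
  have e1 : ∀ v, Y 1 v = -(κ 0 v * C 0) := fun v => by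
    rw [show Y 1 v = Y 0 _ - _ * _ from hY 0 v, hY0]
    simp only [show stustu 0 = 0 from rfl]
    ring
  -- Each formula from here on is the preceding one applied to the reflected vector, minus the new
  -- crossing term; the integers come from the Cartan entries `-2`.
  have e2 : ∀ v, Y 2 v = -((κ 0 v + 2 * κ 1 v) * C 0 + κ 1 v * C 1) := fun v => by
    rw [show Y 2 v = Y 1 _ - _ * _ from hY 1 v, e1]
    simp only [show stustu 1 = 1 from rfl, κne 0 1 (by decide)]
    ring
  have e3 : ∀ v, Y 3 v = -((κ 0 v + 2 * κ 1 v + 6 * κ 2 v) * C 0 + (κ 1 v + 2 * κ 2 v) * C 1 + κ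
      2 v * C 2) := fun v => by
    rw [show Y 3 v = Y 2 _ - _ * _ from hY 2 v, e2]
    simp only [show stustu 2 = 2 from rfl, κne 0 2 (by decide), κne 1 2 (by decide)]
    ring
  have e4 : ∀ v, Y 4 v = -((15 * κ 0 v + 2 * κ 1 v + 6 * κ 2 v) * C 0 + (6 * κ 0 v + κ 1 v + 2 *
      κ 2 v) * C 1 + (2 * κ 0 v + κ 2 v) * C 2 + κ 0 v * C 3) := fun v => by
    rw [show Y 4 v = Y 3 _ - _ * _ from hY 3 v, e3]
    simp only [show stustu 3 = 0 from rfl, κsame, κne 1 0 (by decide), κne 2 0 (by decide)]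
    ring
  have e5 : ∀ v, Y 5 v = -((15 * κ 0 v + 40 * κ 1 v + 6 * κ 2 v) * C 0 + (6 * κ 0 v + 15 * κ 1 v
      + 2 * κ 2 v) * C 1 + (2 * κ 0 v + 6 * κ 1 v + κ 2 v) * C 2 + (κ 0 v + 2 * κ 1 v) * C 3 + κ
      1 v * C 4) := fun v => by
    rw [show Y 5 v = Y 4 _ - _ * _ from hY 4 v, e4]
    simp only [show stustu 4 = 1 from rfl, κsame, κne 0 1 (by decide), κne 2 1 (by decide)]
    ring
  have e6 : ∀ v, Y 6 v = -((15 * κ 0 v + 40 * κ 1 v + 104 * κ 2 v) * C 0 + (6 * κ 0 v + 15 * κ 1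
      v + 40 * κ 2 v) * C 1 + (2 * κ 0 v + 6 * κ 1 v + 15 * κ 2 v) * C 2 + (κ 0 v + 2 * κ 1 v + 6
      * κ 2 v) * C 3 + (κ 1 v + 2 * κ 2 v) * C 4 + κ 2 v * C 5) := fun v => by
    rw [show Y 6 v = Y 5 _ - _ * _ from hY 5 v, e5]
    simp only [show stustu 5 = 2 from rfl, κsame, κne 0 2 (by decide), κne 1 2 (by decide)]
    ring
  -- The quadratic relations result from substituting the roots into the linear forms just found.
  have q0 : C 0 * C 0 = 0 := by
    rw [show C 0 * C 0 = -(Y 0 _ * _) from hC 0, hY0, zero_mul, neg_zero]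
  have q1 : C 1 * C 1 = -((2 * C 0) * C 1) := by
    rw [show C 1 * C 1 = -(Y 1 _ * _) from hC 1, e1]
    simp only [show stustu 1 = 1 from rfl, κroot_ne 0 1 (by decide)]
    ring
  have q2 : C 2 * C 2 = -((6 * C 0 + 2 * C 1) * C 2) := by
    rw [show C 2 * C 2 = -(Y 2 _ * _) from hC 2, e2]
    simp only [show stustu 2 = 2 from rfl, κroot_ne 0 2 (by decide),
      κroot_ne 1 2 (by decide)]
    ring
  have q3 : C 3 * C 3 = -((14 * C 0 + 6 * C 1 + 2 * C 2) * C 3) := by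
    rw [show C 3 * C 3 = -(Y 3 _ * _) from hC 3, e3]
    simp only [show stustu 3 = 0 from rfl, κroot, κroot_ne 1 0 (by decide),
      κroot_ne 2 0 (by decide)]
    ring
  have q4 : C 4 * C 4 = -((38 * C 0 + 14 * C 1 + 6 * C 2 + 2 * C 3) * C 4) := by
    rw [show C 4 * C 4 = -(Y 4 _ * _) from hC 4, e4]
    simp only [show stustu 4 = 1 from rfl, κroot, κroot_ne 0 1 (by decide),
      κroot_ne 2 1 (by decide)]
    ring
  have q5 : C 5 * C 5 = -((98 * C 0 + 38 * C 1 + 14 * C 2 + 6 * C 3 + 2 * C 4) * C 5) := by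
    rw [show C 5 * C 5 = -(Y 5 _ * _) from hC 5, e5]
    simp only [show stustu 5 = 2 from rfl, κroot, κroot_ne 0 2 (by decide),
      κroot_ne 1 2 (by decide)]
    ring

  have key := stustu_annihilation_identity C (κ 0 v) (κ 1 v) (κ 2 v) q0 q1 q2 q3 q4 q5
  rw [← e6 v] at key
  refine Ideal.Quotient.eq_zero_iff_mem.1 ?_
  change π _ = 0
  rw [map_mul, bElt_eq]
  simp only [map_add, map_sub, map_mul, map_ofNat]
  exact key

end Counterexample

/-! ### Elements on which the left and right actions agree. -/

namespace BS

section General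

variable {B : Type*} {W : Type*} [Group W] {M : CoxeterMatrix B} {cs : CoxeterSystem M W}
  {𝕜 : Type u} [Field 𝕜] {V : Type v} [AddCommGroup V] [Module 𝕜 V]

local notation "ιV" => SymmetricAlgebra.ι 𝕜 V

variable (h : Realization cs 𝕜 V) {l : ℕ} (word : Fin l → B)

/-- The submodule of the elements on which the left and the right action of `R` agree. -/
noncomputable def invariants : Submodule (SymV 𝕜 V) (BS h word) where
  carrier := {m | ∀ f : SymV 𝕜 V, op f • m = f • m}
  add_mem' hx hy f := by rw [smul_add, smul_add, hx f, hy f]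
  zero_mem' f := by rw [smul_zero, smul_zero]
  smul_mem' r x hx f := by rw [← smul_comm, hx f, smul_comm]

theorem mem_invariants_iff {m : BS h word} : m ∈ invariants h word ↔
    ∀ f, place h word (Fin.last l) f * m = place h word 0 f * m := Iff.rfl

variable {ϖ : B → V} (hϖ : ∀ i, h.coroot i (ϖ i) = 1)
include hϖ

theorem place_succ_mul_crossingProd {k : Fin l} {T : Finset (Fin l)} (hk : k ∈ T)
    (f : SymV 𝕜 V) : place h word k.succ f * crossingProd h word ϖ T =
      place h word k.castSucc f * crossingProd h word ϖ T := by
  rw [crossingProd, ← Finset.mul_prod_erase T _ hk, ← mul_assoc, ← mul_assoc,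
    place_succ_mul_crossing h word hϖ]

/-- Two places `i < j` with the same letter give an invariant element, if all other places are
crossed. -/
theorem pair_mem_invariants {i j : Fin l} (hij : word i = word j) (m : BS h word)
    (h0 : ∀ f, place h word i.castSucc f * m = place h word 0 f * m)
    (h1 : ∀ f, place h word j.castSucc f * m = place h word i.succ f * m)
    (h2 : ∀ f, place h word (Fin.last l) f * m = place h word j.succ f * m) :
    (crossing h word ϖ i - crossing h word ϖ j + place h word 0 (ιV (h.root (word i)))) * m ∈
      invariants h word := by
  rw [mem_invariants_iff]
  intro f
  refine mul_eq_mul_of_forall_ι _ _ _ (fun v => ?_) f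
  set α := h.root (word i)
  -- With the other places transparent on `m`, this is a computation in `BS(ss)`. There `c ⊗ 1 - 1 ⊗
  -- c + α` evaluates to `α` at the empty and full subexpressions and to `0` at the two with product
  -- `s`, which is why it is invariant.
  have pi : ∀ w, place h word i.succ (ιV w) = place h word i.castSucc (ιV w) -
      algebraMap 𝕜 _ (h.coroot (word i) w) *
        (place h word i.castSucc (ιV α) + crossing h word ϖ i) := fun w => by
    rw [place_succ_ι h word hϖ, h.simple_apply, map_sub, map_sub, map_smul, map_smul,
      Algebra.smul_def, Algebra.smul_def]
    ring
  have pj : ∀ w, place h word j.succ (ιV w) = place h word j.castSucc (ιV w) -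
      algebraMap 𝕜 _ (h.coroot (word i) w) *
        (place h word j.castSucc (ιV α) + crossing h word ϖ j) := fun w => by
    rw [place_succ_ι h word hϖ, h.simple_apply, map_sub, map_sub, map_smul, map_smul,
      Algebra.smul_def, Algebra.smul_def, ← hij]
    ring
  have piα := pi α
  rw [show h.coroot (word i) α = 2 from h.coroot_root _, map_ofNat] at piα
  have si := crossing_sq h word hϖ i
  have sj := crossing_sq h word hϖ j
  rw [← hij] at sj
  change _ = -(place h word i.castSucc (ιV α) * _) at si
  change _ = -(place h word j.castSucc (ιV α) * _) at sj
  set p := algebraMap 𝕜 (BS h word) (h.coroot (word i) v)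
  set c := crossing h word ϖ i
  set d := crossing h word ϖ j
  set D := c - d + place h word 0 (ιV α)
  have hD : D = c - d + place h word 0 (ιV α) := rfl
  -- The terms carry `v` from the last slot to the first across `j` and then `i`; what is left is
  -- `p` times a quadratic expression in the crossings, removed by `si` and `sj`.
  linear_combination D * h2 (ιV v) + D * m * pj v + D * h1 (ιV v) - p * D * h1 (ιV α) +
    D * m * pi v - p * D * m * piα + D * h0 (ιV v) + p * m * si + p * m * sj
    - p * c * h0 (ιV α) - p * d * h1 (ιV α) - p * d * m * piα + p * d * h0 (ιV α)
    + p * m * (c - d) * hD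

end General

section Stustu

variable {W : Type*} [Group W] {cs : CoxeterSystem universalThree W}
  {𝕜 : Type u} [Field 𝕜] {V : Type v} [AddCommGroup V] [Module 𝕜 V]
  (h : Realization cs 𝕜 V) {ϖ : Fin 3 → V}

local notation "ιV" => SymmetricAlgebra.ι 𝕜 V

/-- The action of the simple reflections on the coefficients with respect to the simple roots. -/
def reflectCoeff (i : Fin 3) (x : ℤ × ℤ × ℤ) : ℤ × ℤ × ℤ :=
  match i with
  | 0 => (2 * (x.2.1 + x.2.2) - x.1, x.2.1, x.2.2)
  | 1 => (x.1, 2 * (x.1 + x.2.2) - x.2.1, x.2.2)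
  | 2 => (x.1, x.2.1, 2 * (x.1 + x.2.1) - x.2.2)

/-- The integral combination of the simple roots with the given coefficients. -/
def rootCombination (x : ℤ × ℤ × ℤ) : V :=
  (x.1 : 𝕜) • h.root 0 + (x.2.1 : 𝕜) • h.root 1 + (x.2.2 : 𝕜) • h.root 2

theorem ρ_simple_rootCombination (hcartan : ∀ i j, i ≠ j → h.coroot i (h.root j) = -2)
    (i : Fin 3) (x : ℤ × ℤ × ℤ) : h.ρ (cs.simple i) (rootCombination h x) =
      rootCombination h (reflectCoeff i x) := by
  rw [h.simple_apply]
  fin_cases i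
  · simp [rootCombination, reflectCoeff, h.coroot_root, hcartan 0 1 (by decide),
      hcartan 0 2 (by decide)]
    module
  · simp [rootCombination, reflectCoeff, h.coroot_root, hcartan 1 0 (by decide),
      hcartan 1 2 (by decide)]
    module
  · simp [rootCombination, reflectCoeff, h.coroot_root, hcartan 2 0 (by decide),
      hcartan 2 1 (by decide)]
    module

/-- The coroots recover the coefficients because the Cartan matrix, with `2` on and `-2` off the
diagonal, has determinant `-32`. Characteristic zero allows the equations to be read over `ℤ`. -/
theorem rootCombination_injective [CharZero 𝕜]
    (hcartan : ∀ i j, i ≠ j → h.coroot i (h.root j) = -2) :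
    Function.Injective (rootCombination h) := by
  intro x y hxy
  have h0 := congrArg (h.coroot 0) hxy
  have h1 := congrArg (h.coroot 1) hxy
  have h2 := congrArg (h.coroot 2) hxy
  simp only [rootCombination, map_add, map_smul, h.coroot_root, hcartan 0 1 (by decide),
    hcartan 0 2 (by decide), hcartan 1 0 (by decide), hcartan 1 2 (by decide),
    hcartan 2 0 (by decide), hcartan 2 1 (by decide), smul_eq_mul] at h0 h1 h2
  norm_cast at h0 h1 h2
  refine Prod.ext ?_ (Prod.ext ?_ ?_) <;> omega

/-- The sets of crossed places whose complements are subexpressions of `stustu` for the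
identity. -/
def closedCrossings : Finset (Finset (Fin 6)) :=
  {Finset.univ, {1, 2, 4, 5}, {0, 2, 3, 5}, {0, 1, 3, 4}}

/-- The sum of the simple roots pairs to `-2` with every simple coroot, so it serves as a regular
test vector; integer coordinates make the check over all 64 subexpressions decidable. -/
theorem reflectCoeff_fold_ne (E : Finset (Fin 6)) (hE : Eᶜ ∉ closedCrossings) :
    (List.finRange 6).foldr (fun k x => if k ∈ E then reflectCoeff (stustu k) x else x)
      (1, 1, 1) ≠ (1, 1, 1) := by
  revert E
  decide

theorem ρ_partialProd_rootCombination (hcartan : ∀ i j, i ≠ j → h.coroot i (h.root j) = -2)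
    (E : Finset (Fin 6)) (x : ℤ × ℤ × ℤ) :
    h.ρ (partialProd cs stustu E (Fin.last 6)) (rootCombination h x) =
      rootCombination h ((List.finRange 6).foldr
        (fun k x => if k ∈ E then reflectCoeff (stustu k) x else x) x) := by
  have step : ∀ k y, h.ρ (if k ∈ E then cs.simple (stustu k) else 1) (rootCombination h y) =
      rootCombination h (if k ∈ E then reflectCoeff (stustu k) y else y) := by
    intro k y
    split_ifs
    · exact ρ_simple_rootCombination h hcartan _ _
    · simp
  have fold : ∀ L : List (Fin 6),
      h.ρ (L.map fun k => if k ∈ E then cs.simple (stustu k) else 1).prod (rootCombination h x) =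
        rootCombination h (L.foldr
          (fun k x => if k ∈ E then reflectCoeff (stustu k) x else x) x) := by
    intro L
    induction L with
    | nil => simp
    | cons k L ih =>
      rw [List.map_cons, List.prod_cons, map_mul, Module.End.mul_apply, ih, step, List.foldr_cons]
  rw [← fold, partialProd, Fin.partialProd, List.ofFn_eq_map, List.take_of_length_le (by simp)]

theorem eval_eq_zero_of_notMem_closedCrossings [CharZero 𝕜]
    (hcartan : ∀ i j, i ≠ j → h.coroot i (h.root j) = -2) {m : BS h stustu}
    (hm : m ∈ invariants h stustu) {E : Finset (Fin 6)} (hE : Eᶜ ∉ closedCrossings) :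
    eval h stustu E m = 0 := by
  refine eval_eq_zero_of_invariant h stustu hm (v := rootCombination h (1, 1, 1)) ?_
  rw [ρ_partialProd_rootCombination h hcartan]
  exact (rootCombination_injective h hcartan).ne (reflectCoeff_fold_ne E hE)

variable [CharZero 𝕜] (hcartan : ∀ i j, i ≠ j → h.coroot i (h.root j) = -2)
  (hϖ : ∀ i, h.coroot i (ϖ i) = 1)
include hcartan

theorem repr_eq_zero_of_forall_subset {m : BS h stustu} (hm : m ∈ invariants h stustu)
    (T : Finset (Fin 6)) (hT : ∀ T' ⊆ T, T' ∉ closedCrossings) :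
    (stringBasis h stustu hϖ).repr m T = 0 := by
  refine coeff_eq_zero_of_forall_subset h stustu hϖ _ T fun T' hT' => ?_
  rw [sum_repr_smul_crossingProd]
  refine eval_eq_zero_of_notMem_closedCrossings h hcartan hm ?_
  rw [compl_compl]
  exact hT T' hT'

/-- Evaluation at the complement of `insert i T` vanishes and involves only the coordinates at `T`
and `insert i T`: every other subset of `insert i T` contains no closed set and so has zero
coordinate. The coordinate at `T` is therefore controlled by the one at `insert i T`. -/
theorem repr_eq_zero_of_insert {m : BS h stustu} (hm : m ∈ invariants h stustu)
    {T : Finset (Fin 6)} {i : Fin 6} (hiT : insert i T ∉ closedCrossings)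
    (hsub : ∀ T' ⊆ insert i T, T' ≠ T → T' ≠ insert i T →
      ∀ T'' ⊆ T', T'' ∉ closedCrossings)
    (hi : (stringBasis h stustu hϖ).repr m (insert i T) = 0) :
    (stringBasis h stustu hϖ).repr m T = 0 := by
  refine coeff_eq_zero_of_eval_eq_zero h stustu hϖ _ (E := (insert i T)ᶜ) ?_ ?_ ?_
  · rw [compl_compl]; exact Finset.subset_insert i T
  · intro T' hT' hne
    rw [compl_compl] at hT'
    by_cases h' : T' = insert i T
    · rw [h', hi]
    · exact repr_eq_zero_of_forall_subset h hcartan hϖ hm T' (hsub T' hT' hne h')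
  · rw [sum_repr_smul_crossingProd]
    refine eval_eq_zero_of_notMem_closedCrossings h hcartan hm ?_
    rwa [compl_compl]

/-- An invariant element is determined by four of its coordinates. -/
theorem eq_zero_of_repr_eq_zero {m : BS h stustu} (hm : m ∈ invariants h stustu)
    (h1 : (stringBasis h stustu hϖ).repr m Finset.univ = 0)
    (h2 : (stringBasis h stustu hϖ).repr m (insert 0 {1, 2, 4, 5}) = 0)
    (h3 : (stringBasis h stustu hϖ).repr m (insert 1 {0, 2, 3, 5}) = 0)
    (h4 : (stringBasis h stustu hϖ).repr m (insert 2 {0, 1, 3, 4}) = 0) : m = 0 := by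
  have hc : ∀ T ∈ closedCrossings, (stringBasis h stustu hϖ).repr m T = 0 := by
    intro T hT
    simp only [closedCrossings, Finset.mem_insert, Finset.mem_singleton] at hT
    rcases hT with rfl | rfl | rfl | rfl
    · exact h1
    · exact repr_eq_zero_of_insert h hcartan hϖ hm (by decide) (by decide) h2
    · exact repr_eq_zero_of_insert h hcartan hϖ hm (by decide) (by decide) h3
    · exact repr_eq_zero_of_insert h hcartan hϖ hm (by decide) (by decide) h4
  rw [← (stringBasis h stustu hϖ).repr.map_eq_zero_iff]
  ext T : 1
  rw [Finsupp.zero_apply]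
  -- Outside the closed sets the evaluation at `Tᶜ` vanishes, and by induction it involves only the
  -- coordinate at `T`.
  induction T using Finset.strongInduction with
  | H T ih =>
    by_cases hT : T ∈ closedCrossings
    · exact hc T hT
    · refine coeff_eq_zero_of_eval_eq_zero h stustu hϖ _ (E := Tᶜ) (by simp) (fun T' hT' hne => ?_)
        ?_
      · rw [compl_compl] at hT'
        exact ih T' (hT'.ssubset_of_ne hne)
      · rw [sum_repr_smul_crossingProd]
        refine eval_eq_zero_of_notMem_closedCrossings h hcartan hm ?_
        rwa [compl_compl]

end Stustu

/-! ### Four generators of the invariants, and why `b` is not congruent to an invariant. -/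

section Generators

variable {W : Type*} [Group W] {cs : CoxeterSystem universalThree W}
  {𝕜 : Type u} [Field 𝕜] {V : Type v} [AddCommGroup V] [Module 𝕜 V]
  (h : Realization cs 𝕜 V) {ϖ : Fin 3 → V}

local notation "ιV" => SymmetricAlgebra.ι 𝕜 V

variable (ϖ) in
/-- The element that is supported on the pair of places `i`, `j` with the same letter, all the
places in `T` being crossed. -/
noncomputable def pairElt (i j : Fin 6) (T : Finset (Fin 6)) : BS h stustu :=
  crossingProd h stustu ϖ (insert i T) - crossingProd h stustu ϖ (insert j T) +
    ιV (h.root (stustu i)) • crossingProd h stustu ϖ T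

theorem pairElt_eq_mul {i j : Fin 6} {T : Finset (Fin 6)} (hi : i ∉ T) (hj : j ∉ T) :
    pairElt h ϖ i j T = (crossing h stustu ϖ i - crossing h stustu ϖ j +
      place h stustu 0 (ιV (h.root (stustu i)))) * crossingProd h stustu ϖ T := by
  rw [pairElt, ← crossing_mul_crossingProd_of_notMem h stustu hi,
    ← crossing_mul_crossingProd_of_notMem h stustu hj, smul_eq]
  ring

variable (hϖ : ∀ i, h.coroot i (ϖ i) = 1)

include hϖ in
theorem place_mul_crossingProd {k : Fin 6} {a b : Fin 7} {T : Finset (Fin 6)} (hk : k ∈ T)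
    (ha : a = k.succ) (hb : b = k.castSucc) (f : SymV 𝕜 V) :
    place h stustu a f * crossingProd h stustu ϖ T =
      place h stustu b f * crossingProd h stustu ϖ T := by
  rw [ha, hb, place_succ_mul_crossingProd h stustu hϖ hk]

include hϖ in
theorem crossingProd_univ_mem_invariants :
    crossingProd h stustu ϖ Finset.univ ∈ invariants h stustu := by
  rw [mem_invariants_iff]
  have key : ∀ (k : Fin 7) f, place h stustu k f * crossingProd h stustu ϖ Finset.univ =
      place h stustu 0 f * crossingProd h stustu ϖ Finset.univ := by
    intro k f
    induction k using Fin.induction with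
    | zero => rfl
    | succ k ih => rw [place_succ_mul_crossingProd h stustu hϖ (Finset.mem_univ k), ih]
  exact key _

include hϖ in
theorem pairElt_zero_three_mem_invariants :
    pairElt h ϖ 0 3 {1, 2, 4, 5} ∈ invariants h stustu := by
  rw [pairElt_eq_mul h (by decide) (by decide)]
  have step := fun k a b hk ha hb f =>
    place_mul_crossingProd h hϖ (T := {1, 2, 4, 5}) (k := k) (a := a) (b := b) hk ha hb f
  refine pair_mem_invariants h stustu hϖ (i := 0) (j := 3) (by decide) _ (fun f => ?_)
    (fun f => ?_) fun f => ?_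
  · rw [Fin.castSucc_zero]
  · exact (step 2 _ 2 (by decide) (by decide) (by decide) f).trans
      (step 1 2 _ (by decide) (by decide) (by decide) f)
  · exact (step 5 _ 5 (by decide) (by decide) (by decide) f).trans
      (step 4 5 _ (by decide) (by decide) (by decide) f)

include hϖ in
theorem pairElt_one_four_mem_invariants :
    pairElt h ϖ 1 4 {0, 2, 3, 5} ∈ invariants h stustu := by
  rw [pairElt_eq_mul h (by decide) (by decide)]
  have step := fun k a b hk ha hb f =>
    place_mul_crossingProd h hϖ (T := {0, 2, 3, 5}) (k := k) (a := a) (b := b) hk ha hb f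
  refine pair_mem_invariants h stustu hϖ (i := 1) (j := 4) (by decide) _ (fun f => ?_)
    (fun f => ?_) fun f => ?_
  · exact step 0 _ _ (by decide) (by decide) (by decide) f
  · exact (step 3 _ 3 (by decide) (by decide) (by decide) f).trans
      (step 2 3 _ (by decide) (by decide) (by decide) f)
  · exact step 5 _ _ (by decide) (by decide) (by decide) f

include hϖ in
theorem pairElt_two_five_mem_invariants :
    pairElt h ϖ 2 5 {0, 1, 3, 4} ∈ invariants h stustu := by
  rw [pairElt_eq_mul h (by decide) (by decide)]
  have step := fun k a b hk ha hb f =>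
    place_mul_crossingProd h hϖ (T := {0, 1, 3, 4}) (k := k) (a := a) (b := b) hk ha hb f
  refine pair_mem_invariants h stustu hϖ (i := 2) (j := 5) (by decide) _ (fun f => ?_)
    (fun f => ?_) fun f => ?_
  · exact (step 1 _ 1 (by decide) (by decide) (by decide) f).trans
      (step 0 1 _ (by decide) (by decide) (by decide) f)
  · exact (step 4 _ 4 (by decide) (by decide) (by decide) f).trans
      (step 3 4 _ (by decide) (by decide) (by decide) f)
  · rw [show Fin.last 6 = Fin.succ 5 from by decide]

theorem repr_pairElt (i j : Fin 6) (T T' : Finset (Fin 6)) :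
    (stringBasis h stustu hϖ).repr (pairElt h ϖ i j T) T' =
      (if insert i T = T' then 1 else 0) - (if insert j T = T' then 1 else 0) +
        ιV (h.root (stustu i)) * if T = T' then 1 else 0 := by
  rw [pairElt, map_add, map_sub, map_smul, Finsupp.add_apply, Finsupp.sub_apply,
    Finsupp.smul_apply, repr_crossingProd, repr_crossingProd, repr_crossingProd, smul_eq_mul]

/-- The bimodule of invariant elements is generated by four elements, with the coefficients given
by coordinates. -/
theorem eq_combination_of_mem_invariants [CharZero 𝕜]
    (hcartan : ∀ i j, i ≠ j → h.coroot i (h.root j) = -2) {m : BS h stustu}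
    (hm : m ∈ invariants h stustu) :
    m = (stringBasis h stustu hϖ).repr m Finset.univ • crossingProd h stustu ϖ Finset.univ +
      (stringBasis h stustu hϖ).repr m (insert 0 {1, 2, 4, 5}) • pairElt h ϖ 0 3 {1, 2, 4, 5} +
      (stringBasis h stustu hϖ).repr m (insert 1 {0, 2, 3, 5}) • pairElt h ϖ 1 4 {0, 2, 3, 5} +
      (stringBasis h stustu hϖ).repr m (insert 2 {0, 1, 3, 4}) • pairElt h ϖ 2 5 {0, 1, 3, 4} := by
  rw [← sub_eq_zero]
  refine eq_zero_of_repr_eq_zero h hcartan hϖ ?_ ?_ ?_ ?_ ?_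
  · refine Submodule.sub_mem _ hm (Submodule.add_mem _ (Submodule.add_mem _ (Submodule.add_mem _
      (Submodule.smul_mem _ _ (crossingProd_univ_mem_invariants h hϖ))
      (Submodule.smul_mem _ _ (pairElt_zero_three_mem_invariants h hϖ)))
      (Submodule.smul_mem _ _ (pairElt_one_four_mem_invariants h hϖ)))
      (Submodule.smul_mem _ _ (pairElt_two_five_mem_invariants h hϖ)))
  -- On these four coordinates the generators form the identity matrix. The five-element sets are
  -- used because there the pair elements have coordinate `1`, while at the closed four-element set
  -- it is a root, not a unit.
  all_goals
    simp only [map_sub, map_add, map_smul, Finsupp.sub_apply, Finsupp.add_apply,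
      Finsupp.smul_apply, repr_pairElt, repr_crossingProd, smul_eq_mul]
    simp +decide

theorem repr_bElt : (stringBasis h stustu hϖ).repr (bElt h ϖ) {0, 1, 2, 3} = 1 := by
  simp only [bElt, stringElt_eq_crossingProd, two_mul, map_sub, map_add, Finsupp.sub_apply,
    Finsupp.add_apply, repr_crossingProd]
  simp +decide

/-- Closed sets have at least four elements and `{0, 1, 2, 3}` is not one of them, so triangularity
forces the coordinate to vanish. -/
theorem repr_eq_zero_of_mem_invariants [CharZero 𝕜]
    (hcartan : ∀ i j, i ≠ j → h.coroot i (h.root j) = -2) {m : BS h stustu}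
    (hm : m ∈ invariants h stustu) : (stringBasis h stustu hϖ).repr m {0, 1, 2, 3} = 0 :=
  repr_eq_zero_of_forall_subset h hcartan hϖ hm _ (by decide)

include hϖ in
theorem bElt_sub_notMem_smul_top [CharZero 𝕜]
    (hcartan : ∀ i j, i ≠ j → h.coroot i (h.root j) = -2) {m : BS h stustu}
    (hm : m ∈ invariants h stustu) :
    bElt h ϖ - m ∉ polyPlus 𝕜 V • (⊤ : Submodule (SymV 𝕜 V) (BS h stustu)) := by
  intro hb
  have := (stringBasis h stustu hϖ).repr_mem_of_mem_smul_top _ hb {0, 1, 2, 3}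
  rw [map_sub, Finsupp.sub_apply, repr_bElt, repr_eq_zero_of_mem_invariants h hϖ hcartan hm,
    sub_zero] at this
  exact one_notMem_polyPlus this

-- The coefficients of `m` on the four generators are string coordinates, and all string coordinates
-- of an element of `R_+ BS` lie in `R_+`.
include hϖ in
theorem mem_smul_invariants [CharZero 𝕜]
    (hcartan : ∀ i j, i ≠ j → h.coroot i (h.root j) = -2) {m : BS h stustu}
    (hm : m ∈ invariants h stustu)
    (hI : m ∈ polyPlus 𝕜 V • (⊤ : Submodule (SymV 𝕜 V) (BS h stustu))) :
    m ∈ polyPlus 𝕜 V • invariants h stustu := by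
  have hr := (stringBasis h stustu hϖ).repr_mem_of_mem_smul_top _ hI
  rw [eq_combination_of_mem_invariants h hϖ hcartan hm]
  exact Submodule.add_mem _ (Submodule.add_mem _ (Submodule.add_mem _
      (Submodule.smul_mem_smul (hr _) (crossingProd_univ_mem_invariants h hϖ))
      (Submodule.smul_mem_smul (hr _) (pairElt_zero_three_mem_invariants h hϖ)))
      (Submodule.smul_mem_smul (hr _) (pairElt_one_four_mem_invariants h hϖ)))
      (Submodule.smul_mem_smul (hr _) (pairElt_two_five_mem_invariants h hϖ))

end Generators

end BS

/-! ### Both Hom spaces inside the reduced bimodule. -/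

section General

variable {B : Type*} {W : Type*} [Group W] {M : CoxeterMatrix B} {cs : CoxeterSystem M W}
  {𝕜 : Type u} [Field 𝕜] {V : Type v} [AddCommGroup V] [Module 𝕜 V]

variable (h : Realization cs 𝕜 V) {l : ℕ} (word : Fin l → B)

namespace BS

/-- The bimodule map out of `R` given by an invariant element. -/
noncomputable def homOfInvariant {m : BS h word} (hm : m ∈ invariants h word) :
    BimodHom (SymV 𝕜 V) (SymV 𝕜 V) (BS h word) :=
  ⟨LinearMap.toSpanSingleton _ _ m, fun f x => by
    rw [LinearMap.toSpanSingleton_apply, LinearMap.toSpanSingleton_apply, op_smul_eq_mul,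
      mul_smul, ← smul_comm x (op f) m, hm f]⟩

theorem homOfInvariant_apply_one {m : BS h word} (hm : m ∈ invariants h word) :
    (homOfInvariant h word hm).1 1 = m := one_smul _ m

theorem apply_one_mem_invariants (φ : BimodHom (SymV 𝕜 V) (SymV 𝕜 V) (BS h word)) :
    φ.1 1 ∈ invariants h word := fun f => by
  rw [← φ.2 f 1, ← map_smul, op_smul_eq_mul, smul_eq_mul, one_mul, mul_one]

/-- The evaluation of bimodule maps at `1`. -/
noncomputable def evalOne : BimodHom (SymV 𝕜 V) (SymV 𝕜 V) (BS h word) →ₗ[SymV 𝕜 V] BS h word :=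
  (LinearMap.applyₗ (1 : SymV 𝕜 V)).comp (Submodule.subtype _)

theorem evalOne_apply (φ : BimodHom (SymV 𝕜 V) (SymV 𝕜 V) (BS h word)) :
    evalOne h word φ = φ.1 1 := rfl

theorem evalOne_injective : Function.Injective (evalOne h word) := by
  intro φ ψ hφ
  refine Subtype.ext (LinearMap.ext_ring ?_)
  exact hφ

theorem range_evalOne : LinearMap.range (evalOne h word) = invariants h word := by
  ext m
  refine ⟨?_, fun hm => ⟨homOfInvariant h word hm, homOfInvariant_apply_one h word hm⟩⟩
  rintro ⟨φ, rfl⟩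
  exact apply_one_mem_invariants h word φ

/-- An element `b̄` of the reduction annihilated by `R_+` on the right gives a map of right
modules `1 ↦ b̄`. -/
theorem lTensor_toSpanSingleton_mem_rightHom {b : BS h word}
    (hb : ∀ f ∈ polyPlus 𝕜 V,
      rightMulBar (polyPlus 𝕜 V) (BS h word) f (1 ⊗ₜ[SymV 𝕜 V] b) = 0) :
    ((LinearMap.toSpanSingleton (SymV 𝕜 V) (BS h word) b).lTensor
      (SymV 𝕜 V ⧸ polyPlus 𝕜 V)).restrictScalars 𝕜 ∈
      RightHom 𝕜 (polyPlus 𝕜 V) (SymV 𝕜 V) (BS h word) := by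
  -- Every polynomial is a constant plus an element of `R_+`. Constants act equally on both sides,
  -- and `R_+` kills `1 ⊗ b` from either side.
  have hcomm : ∀ f : SymV 𝕜 V, (1 : SymV 𝕜 V ⧸ polyPlus 𝕜 V) ⊗ₜ[SymV 𝕜 V] (op f • b) =
      (1 : SymV 𝕜 V ⧸ polyPlus 𝕜 V) ⊗ₜ[SymV 𝕜 V] (f • b) := by
    intro f
    obtain ⟨r, hr⟩ := exists_sub_algebraMap_mem_polyPlus f
    obtain ⟨g, hg, rfl⟩ : ∃ g ∈ polyPlus 𝕜 V, f = g + algebraMap 𝕜 _ r :=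
      ⟨_, hr, by ring⟩
    have h1 : op (g + algebraMap 𝕜 (SymV 𝕜 V) r) • b = op g • b + r • b := by
      rw [op_smul_eq, map_add, add_mul, AlgHom.commutes, ← Algebra.smul_def, ← op_smul_eq]
    have h2 : (g + algebraMap 𝕜 (SymV 𝕜 V) r) • b = g • b + r • b := by
      rw [add_smul, algebraMap_smul]
    have h3 : (1 : SymV 𝕜 V ⧸ polyPlus 𝕜 V) ⊗ₜ[SymV 𝕜 V] (g • b) = 0 :=
      (Reduction.one_tmul_eq_zero _).2 (Submodule.smul_mem_smul hg trivial)
    have h4 : (1 : SymV 𝕜 V ⧸ polyPlus 𝕜 V) ⊗ₜ[SymV 𝕜 V] (op g • b) = 0 := hb g hg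
    rw [h1, h2, TensorProduct.tmul_add, TensorProduct.tmul_add, h3, h4]
  intro f x
  obtain ⟨g, rfl⟩ := Reduction.exists_eq_one_tmul _ x
  change (1 : SymV 𝕜 V ⧸ polyPlus 𝕜 V) ⊗ₜ[SymV 𝕜 V] ((op f • g) • b) =
    1 ⊗ₜ[SymV 𝕜 V] (op f • (g • b))
  rw [op_smul_eq_mul, mul_smul, ← smul_comm g (op f) b]
  exact (TensorProduct.tmul_smul g _ _).trans
    ((congrArg (g • ·) (hcomm f).symm).trans (TensorProduct.tmul_smul g _ _).symm)

theorem lTensor_mem_rightHom (φ : BimodHom (SymV 𝕜 V) (SymV 𝕜 V) (BS h word)) :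
    (φ.1.lTensor (SymV 𝕜 V ⧸ polyPlus 𝕜 V)).restrictScalars 𝕜 ∈
      RightHom 𝕜 (polyPlus 𝕜 V) (SymV 𝕜 V) (BS h word) := by
  intro f x
  obtain ⟨g, rfl⟩ := Reduction.exists_eq_one_tmul _ x
  change (1 : SymV 𝕜 V ⧸ polyPlus 𝕜 V) ⊗ₜ[SymV 𝕜 V] (φ.1 (op f • g)) =
    1 ⊗ₜ[SymV 𝕜 V] (op f • (φ.1 g))
  rw [φ.2]

/-- The evaluation of maps of right modules at `1`. -/
noncomputable def evalOneBar : RightHom 𝕜 (polyPlus 𝕜 V) (SymV 𝕜 V) (BS h word) →ₗ[𝕜]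
    Reduction (polyPlus 𝕜 V) (BS h word) :=
  (LinearMap.applyₗ ((1 : SymV 𝕜 V ⧸ polyPlus 𝕜 V) ⊗ₜ[SymV 𝕜 V] (1 : SymV 𝕜 V))).comp
    (Submodule.subtype _)

/-- As a right module the reduction of `R` is generated by `1 ⊗ 1`. -/
theorem evalOneBar_injective : Function.Injective (evalOneBar h word) := by
  intro φ ψ hφψ
  refine Subtype.ext (LinearMap.ext fun x => ?_)
  obtain ⟨f, rfl⟩ := Reduction.exists_eq_one_tmul _ x
  have hx : (1 : SymV 𝕜 V ⧸ polyPlus 𝕜 V) ⊗ₜ[SymV 𝕜 V] f =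
      rightMulBar (polyPlus 𝕜 V) (SymV 𝕜 V) f (1 ⊗ₜ[SymV 𝕜 V] 1) := by
    change _ = (1 : SymV 𝕜 V ⧸ polyPlus 𝕜 V) ⊗ₜ[SymV 𝕜 V] (op f • (1 : SymV 𝕜 V))
    rw [op_smul_eq_mul, one_mul]
  rw [hx, φ.2, ψ.2]
  congr 1

/-- The comparison of the two Hom spaces, after evaluation at `1`. -/
noncomputable def compareOne : Reduction (polyPlus 𝕜 V)
    (BimodHom (SymV 𝕜 V) (SymV 𝕜 V) (BS h word)) →ₗ[𝕜] Reduction (polyPlus 𝕜 V) (BS h word) :=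
  ((evalOne h word).lTensor (SymV 𝕜 V ⧸ polyPlus 𝕜 V)).restrictScalars 𝕜

theorem compareOne_one_tmul (φ : BimodHom (SymV 𝕜 V) (SymV 𝕜 V) (BS h word)) :
    compareOne h word (1 ⊗ₜ[SymV 𝕜 V] φ) = 1 ⊗ₜ[SymV 𝕜 V] φ.1 1 := rfl

theorem range_compareOne_le :
    LinearMap.range (compareOne h word) ≤ LinearMap.range (evalOneBar h word) := by
  rintro _ ⟨x, rfl⟩
  obtain ⟨φ, rfl⟩ := Reduction.exists_eq_one_tmul _ x
  exact ⟨⟨_, lTensor_mem_rightHom h word φ⟩, rfl⟩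

/-- Tensoring with `R/R_+` keeps the inclusion of the invariants injective precisely when they meet
`R_+ BS` only in `R_+` times themselves, which is the hypothesis. -/
theorem compareOne_injective
    (hI : ∀ m ∈ invariants h word,
      m ∈ polyPlus 𝕜 V • (⊤ : Submodule (SymV 𝕜 V) (BS h word)) →
        m ∈ polyPlus 𝕜 V • invariants h word) :
    Function.Injective (compareOne h word) := by
  refine (injective_iff_map_eq_zero _).2 fun x hx => ?_
  obtain ⟨φ, rfl⟩ := Reduction.exists_eq_one_tmul _ x
  rw [compareOne_one_tmul, Reduction.one_tmul_eq_zero] at hx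
  have h1 := hI _ (apply_one_mem_invariants h word φ) hx
  rw [← range_evalOne, LinearMap.range_eq_map, ← Submodule.map_smul''] at h1
  obtain ⟨ψ, hψ, hφψ⟩ := h1
  rw [← evalOne_apply] at hφψ
  rw [← evalOne_injective h word hφψ]
  exact one_tmul_eq_zero_of_mem_smul_top _ hψ

theorem finite_reduction {ϖ : B → V} (hϖ : ∀ i, h.coroot i (ϖ i) = 1) :
    Module.Finite 𝕜 (Reduction (polyPlus 𝕜 V) (BS h word)) := by
  have := Module.Finite.of_basis (stringBasis h word hϖ)
  exact Module.Finite.trans (SymV 𝕜 V ⧸ polyPlus 𝕜 V) _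

end BS

end General

/-! ### The counterexample. -/

section Counterexample

variable {W : Type*} [Group W] {cs : CoxeterSystem universalThree W}
  {𝕜 : Type u} [Field 𝕜] {V : Type v} [AddCommGroup V] [Module 𝕜 V]
  (h : Realization cs 𝕜 V) {ϖ : Fin 3 → V}

theorem rightMulBar_bElt (hcartan : ∀ i j, i ≠ j → h.coroot i (h.root j) = -2)
    (hϖ : ∀ i, h.coroot i (ϖ i) = 1) (f : SymV 𝕜 V) (hf : f ∈ polyPlus 𝕜 V) :
    rightMulBar (polyPlus 𝕜 V) (BS h stustu) f (1 ⊗ₜ[SymV 𝕜 V] bElt h ϖ) = 0 := by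
  change (1 : SymV 𝕜 V ⧸ polyPlus 𝕜 V) ⊗ₜ[SymV 𝕜 V] (op f • bElt h ϖ) = 0
  rw [Reduction.one_tmul_eq_zero, BS.op_smul_eq]
  refine BS.mem_plusIdeal h stustu ?_
  rw [polyPlus_eq_span] at hf
  induction hf using Submodule.span_induction with
  | mem x hx =>
    obtain ⟨v, rfl⟩ := hx
    exact place_last_ι_mul_bElt_mem h hcartan hϖ v
  | zero => rw [map_zero, zero_mul]; exact Ideal.zero_mem _
  | add x y _ _ hx hy => rw [map_add, add_mul]; exact Ideal.add_mem _ hx hy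
  | smul r x _ hx =>
    rw [smul_eq_mul, map_mul, mul_assoc]
    exact Ideal.mul_mem_left _ _ hx

theorem one_tmul_bElt_ne [CharZero 𝕜]
    (hcartan : ∀ i j, i ≠ j → h.coroot i (h.root j) = -2)
    (hϖ : ∀ i, h.coroot i (ϖ i) = 1) {m : BS h stustu} (hm : m ∈ BS.invariants h stustu) :
    (1 : SymV 𝕜 V ⧸ polyPlus 𝕜 V) ⊗ₜ[SymV 𝕜 V] bElt h ϖ ≠ 1 ⊗ₜ[SymV 𝕜 V] m := by
  intro hb
  rw [← sub_eq_zero, ← TensorProduct.tmul_sub, Reduction.one_tmul_eq_zero] at hb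
  exact BS.bElt_sub_notMem_smul_top h hϖ hcartan hm hb

end Counterexample

end SoergelModules

theorem mainTheorem7 {W : Type*} [Group W] (cs : CoxeterSystem universalThree W)
    {𝕜 : Type*} [Field 𝕜] [CharZero 𝕜] {V : Type*} [AddCommGroup V] [Module 𝕜 V]
    [FiniteDimensional 𝕜 V] (h : Realization cs 𝕜 V)
    (hcartan : ∀ i j, i ≠ j → h.coroot i (h.root j) = -2)
    (ϖ : Fin 3 → V) (hϖ : ∀ i, h.coroot i (ϖ i) = 1) :
    -- `b` is homogeneous of degree `2`
    bElt h ϖ ∈ BS.degree h stustu 2 ∧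
    -- its image in `𝕜 ⊗_R BS(stustu)` is annihilated by `R_+` acting on the right
    (∀ f ∈ polyPlus 𝕜 V,
      rightMulBar (polyPlus 𝕜 V) (BS h stustu) f (1 ⊗ₜ[SymV 𝕜 V] bElt h ϖ) = 0) ∧
    -- so `1 ↦ b̄` is a map of right `R`-modules, which no bimodule map `R → BS(stustu)` induces
    (∃ ψ ∈ RightHom 𝕜 (polyPlus 𝕜 V) (SymV 𝕜 V) (BS h stustu),
      ψ (1 ⊗ₜ[SymV 𝕜 V] 1) = 1 ⊗ₜ[SymV 𝕜 V] bElt h ϖ ∧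
      ∀ φ ∈ BimodHom (SymV 𝕜 V) (SymV 𝕜 V) (BS h stustu),
        ¬ ∀ x, ψ x = φ.lTensor (SymV 𝕜 V ⧸ polyPlus 𝕜 V) x) ∧
    -- and `𝕜 ⊗_R Hom_{R ⊗ R}(R, BS(stustu))` and `Hom_R(𝕜 ⊗_R R, 𝕜 ⊗_R BS(stustu))`
    -- are not isomorphic, not even as vector spaces
    IsEmpty (Reduction (polyPlus 𝕜 V) (BimodHom (SymV 𝕜 V) (SymV 𝕜 V) (BS h stustu)) ≃ₗ[𝕜]
      RightHom 𝕜 (polyPlus 𝕜 V) (SymV 𝕜 V) (BS h stustu)) := by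
  have hb := rightMulBar_bElt h hcartan hϖ
  have hψ := BS.lTensor_toSpanSingleton_mem_rightHom h stustu hb
  have hψ1 : (LinearMap.toSpanSingleton (SymV 𝕜 V) (BS h stustu) (bElt h ϖ)).lTensor
      (SymV 𝕜 V ⧸ polyPlus 𝕜 V) (1 ⊗ₜ[SymV 𝕜 V] 1) = 1 ⊗ₜ[SymV 𝕜 V] bElt h ϖ := by
    rw [LinearMap.lTensor_tmul, LinearMap.toSpanSingleton_apply, one_smul]
  refine ⟨bElt_mem_degree h ϖ, hb, ⟨_, hψ, hψ1, fun φ hφ hx => ?_⟩, ⟨fun L => ?_⟩⟩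
  · refine one_tmul_bElt_ne h hcartan hϖ (BS.apply_one_mem_invariants h stustu ⟨φ, hφ⟩) ?_
    rw [← hψ1]
    exact hx (1 ⊗ₜ[SymV 𝕜 V] 1)
  · have := BS.finite_reduction h stustu hϖ
    have hinj := BS.compareOne_injective h stustu
      fun m hm => BS.mem_smul_invariants h hϖ hcartan hm
    -- An abstract isomorphism equates the finite dimensions of the two nested ranges, hence the
    -- ranges themselves; `b̄` would then come from a bimodule map.
    have hrange := Submodule.eq_of_le_of_finrank_eq (BS.range_compareOne_le h stustu) (by
      rw [LinearMap.finrank_range_of_inj hinj,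
        LinearMap.finrank_range_of_inj (BS.evalOneBar_injective h stustu), L.finrank_eq])
    have hmem : (1 : SymV 𝕜 V ⧸ polyPlus 𝕜 V) ⊗ₜ[SymV 𝕜 V] bElt h ϖ ∈
        LinearMap.range (BS.compareOne h stustu) := by
      rw [hrange]
      exact ⟨⟨_, hψ⟩, hψ1⟩
    obtain ⟨x, hx⟩ := hmem
    obtain ⟨φ, rfl⟩ := Reduction.exists_eq_one_tmul _ x
    exact one_tmul_bElt_ne h hcartan hϖ (BS.apply_one_mem_invariants h stustu φ) hx.symm
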